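/- There exist universal constants $c,c'>0$ such that the following holds for every irreducible reversible discrete-time Markov chain on a finite state space, with transition matrix $P$ and stationary distribution $\pi$ (so $\pi(x)P(x,y)=\pi(y)P(y,x)$ for all $x,y$). Let $P_L=\frac{P+I}{2}$ be the transition matrix of the lazy version of the chain and let $$t_{\mathrm L}=\min\Big\{t\in\{0,1,2,\dots\}:\ \max_x \|P_L^t(x,\cdot)-\pi\|\le \tfrac14\Big\},$$ where $\|\mu-\nu\|=\frac12\sum_y|\mu(y)-\nu(y)|$ is the total variation distance; the set in this definition is non-empty. Let $$t_{\mathrm{stop}}=\max_x\ \inf\{\mathbb{E}_x[\Lambda]\ :\ \Lambda \text{ is a stopping time with } \mathbb{P}_x(X_\Lambda=y)=\pi(y)\text{ for all }y\},$$ where $X$ is the (non-lazy) chain with transition matrix $P$ started at $x$, and stopping times may be randomized, i.e. they are stopping times with respect to any filtration, on any probability space, for which $X$ is a Markov chain with transition matrix $P$. Then $$c\,t_{\mathrm L}\le t_{\mathrm{stop}}\le c'\,t_{\mathrm L}.$$ -/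

import Mathlib

open MeasureTheory
open scoped ENNReal NNReal

/-- `π` is a stationary distribution of the transition matrix `P`: a probability vector with
`π P = π`. -/
structure IsStationaryDistribution {V : Type*} [Fintype V] (P : Matrix V V ℝ) (π : V → ℝ) :
    Prop where
  nonneg : ∀ x, 0 ≤ π x
  sum_eq_one : ∑ x, π x = 1
  stationary : Matrix.vecMul π P = π

/-- `P` is the transition matrix of an irreducible reversible Markov chain on the finite state
space `V`, with stationary distribution `π`. -/
structure IsReversibleChain {V : Type*} [Fintype V] [DecidableEq V] (P : Matrix V V ℝ)
    (π : V → ℝ) : Prop where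
  stochastic : P ∈ Matrix.rowStochastic ℝ V
  irreducible : P.IsIrreducible
  stationary : IsStationaryDistribution P π
  reversible : ∀ x y, π x * P x y = π y * P y x

/-- Total variation distance between two probability vectors on a finite set. -/
noncomputable def tvDist {V : Type*} [Fintype V] (μ ν : V → ℝ) : ℝ :=
  (1 / 2) * ∑ y, |μ y - ν y|

/-- Transition matrix `(P + I) / 2` of the lazy version of the chain. -/
noncomputable def lazyMatrix {V : Type*} [DecidableEq V] (P : Matrix V V ℝ) : Matrix V V ℝ :=
  (1 / 2 : ℝ) • (P + 1)

/-- `d_L(t)`: the maximum over starting states `x` of the total variation distance between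
`P_L^t(x, ·)` and `π`. -/
noncomputable def dLazy {V : Type*} [Fintype V] [DecidableEq V] (P : Matrix V V ℝ) (π : V → ℝ)
    (t : ℕ) : ℝ :=
  ⨆ x : V, tvDist (fun y => (lazyMatrix P ^ t) x y) π

/-- `t_L(ε) = min {t ≥ 0 : d_L(t) ≤ ε}`: the mixing time of the lazy chain. -/
noncomputable def tLazy {V : Type*} [Fintype V] [DecidableEq V] (P : Matrix V V ℝ) (π : V → ℝ)
    (ε : ℝ) : ℕ :=
  sInf {t : ℕ | dLazy P π t ≤ ε}

/-- On the probability space `(Ω, μ)`, the process `X` is a Markov chain with respect to the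
filtration `ℱ`, with transition matrix `P` and initial state `x`. The filtration may be larger
than the natural one of `X` (it may carry independent extra randomness). -/
structure IsMarkovChainFrom {V : Type*} (P : Matrix V V ℝ) (x : V) {Ω : Type*}
    [m : MeasurableSpace Ω] (μ : Measure Ω) (ℱ : Filtration ℕ m) (X : ℕ → Ω → V) : Prop where
  adapted : ∀ n y, MeasurableSet[ℱ n] {ω | X n ω = y}
  start : ∀ᵐ ω ∂μ, X 0 ω = x
  markov : ∀ n (A : Set Ω), MeasurableSet[ℱ n] A → ∀ y z,
    μ {ω | ω ∈ A ∧ X n ω = y ∧ X (n + 1) ω = z} =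
      μ {ω | ω ∈ A ∧ X n ω = y} * ENNReal.ofReal (P y z)

/-- The set of all values `𝔼_x[Λ]`, where `Λ` is a (possibly randomized) stopping time of the chain
started at `x` for which `X_Λ` has law exactly `π`. As `π` is a probability vector, the condition
on the law forces `Λ < ∞` almost surely. -/
def stationaryStoppingMeans.{u} {V : Type u} (P : Matrix V V ℝ) (π : V → ℝ) (x : V) :
    Set ℝ≥0∞ :=
  {e | ∃ (Ω : Type u) (m : MeasurableSpace Ω) (μ : Measure Ω) (ℱ : Filtration ℕ m)
      (X : ℕ → Ω → V) (Λ : Ω → ℕ∞),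
    IsProbabilityMeasure μ ∧ IsMarkovChainFrom P x μ ℱ X ∧ IsStoppingTime ℱ Λ ∧
    (∀ y, μ {ω | ∃ n : ℕ, Λ ω = n ∧ X n ω = y} = ENNReal.ofReal (π y)) ∧
    e = ∫⁻ ω, (Λ ω : ℝ≥0∞) ∂μ}

/-- `t_stop`: the maximum over starting states of the least expectation of a stopping time that
achieves exactly the distribution `π`. -/
noncomputable def tStop {V : Type*} (P : Matrix V V ℝ) (π : V → ℝ) : ℝ≥0∞ :=
  ⨆ x : V, sInf (stationaryStoppingMeans P π x)

/-! ### Occupation vectors and the filling rule -/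

section Flows

set_option linter.unusedSectionVars false

open scoped Matrix
open Finset Filter Topology

variable {V : Type*} [Fintype V] [DecidableEq V] {P : Matrix V V ℝ} {π : V → ℝ} {x : V}

/-! Both times are compared with the mass of nonnegative solutions of `G (I - P) = δ_x - π`.
Expected visit counts before a stationary stopping time of finite mean form such a `G`, of mass
equal to that mean. Conversely, the filling rule stops with law `π` and nowhere spends more time
than `G` (`exists_isStoppingFlow`); randomized flags turn it into a genuine stopping time. As `I -
P_L = (I - P) / 2`, laziness only doubles `G`.

For `t_stop ≤ 4 t_L`, reversibility turns total variation `1/4` at time `t` into `P_L^(2t) ≥ π/4`,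
and regenerating in blocks of length `2t` gives a lazy occupation vector of mass `8t`.

For `t_L ≤ 264 t_stop`, let every state have a lazy occupation vector of mass at most `T`. If `f` is
centred, the sums of `P_L^k f` telescope against `G`, so they are `O(T)` and time averages over `r ≫
T` steps are small. The spectrum of `P_L` lies in `[0, 1]`, so a square function controls the gap
between `P_L^n f` and its time averages for all `n` in a range at once. Hence a single function with
small `π`-mean dominates `|P_L^n f|` for `2r ≤ n ≤ 3r` (`IsPositiveChain.exists_maximal_bound`).
Uniformity in `n` is what allows stopping at a random time: the law stopped before `r` lies below
`π`, between `2r` and `3r` steps remain, and the mass not yet stopped is at most `T/r`. -/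

/-- `G` is an occupation vector for reaching the law `π` from `x`: a nonnegative solution of
`G (I - P) = δ_x - π`. -/
structure IsOccupation (P : Matrix V V ℝ) (π : V → ℝ) (x : V) (G : V → ℝ) : Prop where
  nonneg : ∀ y, 0 ≤ G y
  balance : G + π = Pi.single x 1 + G ᵥ* P

/-- A randomized stopping rule for the chain started at `x`, in terms of masses: `s n y` is the
mass stopped in `y` at time `n`, `g n y` the mass that is in `y` at time `n` and moves on, and
`π y` is the total mass stopped in `y`. -/
structure IsStoppingFlow (P : Matrix V V ℝ) (π : V → ℝ) (x : V) (s g : ℕ → V → ℝ) : Prop where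
  stop_nonneg : ∀ n y, 0 ≤ s n y
  go_nonneg : ∀ n y, 0 ≤ g n y
  init : s 0 + g 0 = Pi.single x 1
  step : ∀ n, s (n + 1) + g (n + 1) = g n ᵥ* P
  hasSum : ∀ y, HasSum (fun n => s n y) (π y)

lemma sum_vecMul_of_mem_rowStochastic (hP : P ∈ Matrix.rowStochastic ℝ V) (v : V → ℝ) :
    ∑ y, (v ᵥ* P) y = ∑ y, v y := by
  simp only [Matrix.vecMul, dotProduct]
  rw [sum_comm]
  simp [← mul_sum, Matrix.sum_row_of_mem_rowStochastic hP]

lemma sum_single_one (x : V) : ∑ y, (Pi.single x 1 : V → ℝ) y = 1 := by simp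

lemma single_one_nonneg (x y : V) : 0 ≤ (Pi.single x 1 : V → ℝ) y := by
  rw [Pi.single_apply]
  split_ifs <;> norm_num

/-- The filling rule: the pair of the mass stopped before time `n` and the mass arriving at
time `n`, when at each time as much mass is stopped as `π` leaves room for. -/
noncomputable def filling (P : Matrix V V ℝ) (π : V → ℝ) (x : V) : ℕ → (V → ℝ) × (V → ℝ)
  | 0 => (0, Pi.single x 1)
  | n + 1 =>
    let q := filling P π x n
    (q.1 + q.2 ⊓ (π - q.1), (q.2 - q.2 ⊓ (π - q.1)) ᵥ* P)

noncomputable def fillingStop (P : Matrix V V ℝ) (π : V → ℝ) (x : V) (n : ℕ) : V → ℝ :=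
  (filling P π x n).2 ⊓ (π - (filling P π x n).1)

noncomputable def fillingGo (P : Matrix V V ℝ) (π : V → ℝ) (x : V) (n : ℕ) : V → ℝ :=
  (filling P π x n).2 - fillingStop P π x n

lemma filling_fst (n : ℕ) : (filling P π x n).1 = ∑ k ∈ range n, fillingStop P π x k := by
  induction n with
  | zero => rfl
  | succ n ih => rw [sum_range_succ, ← ih]; rfl

lemma fillingStop_add_fillingGo (n : ℕ) :
    fillingStop P π x n + fillingGo P π x n = (filling P π x n).2 := by
  simp [fillingGo]

lemma filling_fst_le (hπ : ∀ y, 0 ≤ π y) (n : ℕ) : (filling P π x n).1 ≤ π := by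
  induction n with
  | zero => exact hπ
  | succ n ih =>
    intro y
    have : (filling P π x n).2 y ⊓ (π y - (filling P π x n).1 y) ≤ _ := inf_le_right
    simp only [filling, Pi.add_apply, Pi.inf_apply, Pi.sub_apply]
    linarith

lemma fillingGo_nonneg (n : ℕ) (y : V) : 0 ≤ fillingGo P π x n y := by
  have : (filling P π x n).2 y ⊓ (π y - (filling P π x n).1 y) ≤ _ := inf_le_left
  simp only [fillingGo, fillingStop, Pi.sub_apply, Pi.inf_apply]
  linarith

lemma filling_snd_nonneg (hP : P ∈ Matrix.rowStochastic ℝ V) (n : ℕ) (y : V) :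
    0 ≤ (filling P π x n).2 y := by
  cases n with
  | zero => exact single_one_nonneg x y
  | succ n => exact Matrix.nonneg_vecMul_of_mem_rowStochastic hP (fillingGo_nonneg n) y

lemma fillingStop_nonneg (hP : P ∈ Matrix.rowStochastic ℝ V) (hπ : ∀ y, 0 ≤ π y) (n : ℕ) (y : V) :
    0 ≤ fillingStop P π x n y :=
  le_inf (filling_snd_nonneg hP n y) (sub_nonneg.2 (filling_fst_le hπ n y))

lemma fillingGo_eq_zero_or (n : ℕ) (y : V) :
    fillingGo P π x n y = 0 ∨ (filling P π x (n + 1)).1 y = π y := by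
  simp only [fillingGo, fillingStop, filling, Pi.sub_apply, Pi.add_apply, Pi.inf_apply]
  rcases le_total ((filling P π x n).2 y) (π y - (filling P π x n).1 y) with h | h
  · left; rw [inf_eq_left.2 h]; ring
  · right; rw [inf_eq_right.2 h]; ring

/-- A full site stays full, and mass leaves a site only once it is full. -/
lemma fillingGo_eq_zero_of_lt (hP : P ∈ Matrix.rowStochastic ℝ V) (hπ : ∀ y, 0 ≤ π y) {n k : ℕ}
    (hk : k ≤ n) {y : V} (h : (filling P π x (n + 1)).1 y < π y) : fillingGo P π x k y = 0 := by
  refine (fillingGo_eq_zero_or k y).resolve_right fun hk' => h.not_ge ?_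
  rw [← hk', filling_fst, filling_fst, Finset.sum_apply, Finset.sum_apply]
  exact sum_le_sum_of_subset_of_nonneg (range_mono (by lia))
    fun i _ _ => fillingStop_nonneg hP hπ i y

/-- Finite-time form of the occupation balance: both sides count the arrivals up to time `n`. -/
lemma filling_balance (n : ℕ) :
    (filling P π x (n + 1)).1 + ∑ k ∈ range (n + 1), fillingGo P π x k =
      Pi.single x 1 + (∑ k ∈ range n, fillingGo P π x k) ᵥ* P := by
  rw [filling_fst, ← sum_add_distrib]
  simp only [fillingStop_add_fillingGo]
  rw [sum_range_succ', Matrix.sum_vecMul, add_comm]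
  rfl

/-- The filling rule spends the least possible time everywhere. -/
lemma sum_fillingGo_le (hP : P ∈ Matrix.rowStochastic ℝ V) (hπ : ∀ y, 0 ≤ π y) {G : V → ℝ}
    (hG : IsOccupation P π x G) (n : ℕ) (y : V) : (∑ k ∈ range n, fillingGo P π x k) y ≤ G y := by
  induction n generalizing y with
  | zero => simpa using hG.nonneg y
  | succ n ih =>
    -- An unfilled site has released nothing. At a filled site the stopped mass is `π y`, so the two
    -- balance equations can be compared using the induction hypothesis for incoming mass.
    rcases (filling_fst_le (P := P) (x := x) hπ (n + 1) y).lt_or_eq with h | h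
    · rw [Finset.sum_apply, sum_eq_zero]
      · exact hG.nonneg y
      · intro k hk
        exact fillingGo_eq_zero_of_lt hP hπ (by simpa [Nat.lt_succ_iff] using hk) h
    · have h1 := congrFun (filling_balance (P := P) (π := π) (x := x) n) y
      have h2 := congrFun hG.balance y
      have h3 := Matrix.nonneg_vecMul_of_mem_rowStochastic hP
        (x := G - ∑ k ∈ range n, fillingGo P π x k) (fun i => sub_nonneg.2 (ih i)) y
      rw [Matrix.sub_vecMul] at h3
      simp only [Pi.add_apply, Pi.sub_apply] at h1 h2 h3
      linarith

lemma sum_filling_fst_add (hP : P ∈ Matrix.rowStochastic ℝ V) (n : ℕ) :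
    ∑ y, (filling P π x (n + 1)).1 y + ∑ y, fillingGo P π x n y = 1 := by
  have h := congrArg (fun v : V → ℝ => ∑ y, v y) (filling_balance (P := P) (π := π) (x := x) n)
  simp only [Pi.add_apply, sum_add_distrib, sum_vecMul_of_mem_rowStochastic hP] at h
  rw [sum_single_one, sum_range_succ] at h
  simp only [Pi.add_apply, sum_add_distrib] at h
  linarith

/-- The bound by `G` makes the moving masses summable, so they tend to zero and every site fills up
in the limit. -/
theorem exists_isStoppingFlow (hP : P ∈ Matrix.rowStochastic ℝ V) (hπ : ∀ y, 0 ≤ π y)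
    (hπ1 : ∑ y, π y = 1) {G : V → ℝ} (hG : IsOccupation P π x G) :
    ∃ s g, IsStoppingFlow P π x s g ∧ ∀ n, ∑ k ∈ range n, ∑ y, g k y ≤ ∑ y, G y := by
  have hle (n : ℕ) : ∑ k ∈ range n, ∑ y, fillingGo P π x k y ≤ ∑ y, G y := by
    rw [sum_comm]
    refine sum_le_sum fun y _ => ?_
    simpa using sum_fillingGo_le hP hπ hG n y
  refine ⟨fillingStop P π x, fillingGo P π x, ⟨fillingStop_nonneg hP hπ, fillingGo_nonneg,
    fillingStop_add_fillingGo 0, fun n => fillingStop_add_fillingGo (n + 1), fun y => ?_⟩, hle⟩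
  rw [hasSum_iff_tendsto_nat_of_nonneg (fun n => fillingStop_nonneg hP hπ n y),
    ← tendsto_add_atTop_iff_nat 1]
  have h0 : Tendsto (fun n => ∑ y, fillingGo P π x n y) atTop (𝓝 0) :=
    (summable_of_sum_range_le (fun n => sum_nonneg fun y _ => fillingGo_nonneg n y)
      hle).tendsto_atTop_zero
  have h1 : Tendsto (fun n => π y - ∑ y, fillingGo P π x n y) atTop (𝓝 (π y)) := by
    simpa using h0.const_sub (π y)
  refine tendsto_of_tendsto_of_tendsto_of_le_of_le h1 tendsto_const_nhds (fun n => ?_) fun n => ?_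
  · have h2 := sum_filling_fst_add (P := P) (π := π) (x := x) hP n
    -- All deficits are nonnegative and add up to the mass still moving.
    have h3 : π y - (filling P π x (n + 1)).1 y ≤ ∑ z, (π z - (filling P π x (n + 1)).1 z) :=
      single_le_sum (f := fun z => π z - (filling P π x (n + 1)).1 z)
        (fun z _ => sub_nonneg.2 (filling_fst_le hπ (n + 1) z)) (mem_univ y)
    rw [sum_sub_distrib, hπ1] at h3
    have h4 := congrFun (filling_fst (P := P) (π := π) (x := x) (n + 1)) y
    rw [Finset.sum_apply] at h4
    simp only
    linarith
  · have h4 := congrFun (filling_fst (P := P) (π := π) (x := x) (n + 1)) y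
    rw [Finset.sum_apply] at h4
    simp only
    rw [← h4]
    exact filling_fst_le hπ (n + 1) y

end Flows

/-! ### Spectral estimates for positive reversible chains -/

section Mixing

set_option linter.unusedSectionVars false

open scoped Matrix
open Finset Filter Topology

variable {V : Type*} [Fintype V] [DecidableEq V] {P Q : Matrix V V ℝ} {π : V → ℝ} {x : V}

/-- The inner product of `L²(π)`. -/
def weightedInner (π : V → ℝ) (f h : V → ℝ) : ℝ := ∑ y, π y * (f y * h y)

lemma weightedInner_comm (f h : V → ℝ) : weightedInner π f h = weightedInner π h f := by
  simp only [weightedInner, mul_comm]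

lemma weightedInner_sub_left (f g h : V → ℝ) :
    weightedInner π (f - g) h = weightedInner π f h - weightedInner π g h := by
  simp only [weightedInner, ← sum_sub_distrib, Pi.sub_apply]
  exact sum_congr rfl fun y _ => by ring

lemma weightedInner_sub_right (f g h : V → ℝ) :
    weightedInner π f (g - h) = weightedInner π f g - weightedInner π f h := by
  rw [weightedInner_comm, weightedInner_sub_left, weightedInner_comm g, weightedInner_comm h]

lemma weightedInner_self_nonneg (hπ : ∀ y, 0 ≤ π y) (f : V → ℝ) : 0 ≤ weightedInner π f f :=
  sum_nonneg fun y _ => mul_nonneg (hπ y) (mul_self_nonneg _)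

/-- `Q` is a stochastic matrix that is, as an operator on `L²(π)`, self-adjoint with spectrum
in `[0, 1]`. -/
structure IsPositiveChain (Q : Matrix V V ℝ) (π : V → ℝ) : Prop where
  stochastic : Q ∈ Matrix.rowStochastic ℝ V
  stationary : IsStationaryDistribution Q π
  symm : ∀ f h, weightedInner π (Q *ᵥ f) h = weightedInner π f (Q *ᵥ h)
  inner_nonneg : ∀ f, 0 ≤ weightedInner π f (Q *ᵥ f)
  inner_le : ∀ f, weightedInner π f (Q *ᵥ f) ≤ weightedInner π f f

lemma weightedInner_mulVec_comm (h : ∀ x y, π x * P x y = π y * P y x) (f g : V → ℝ) :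
    weightedInner π (P *ᵥ f) g = weightedInner π f (P *ᵥ g) := by
  simp only [weightedInner, Matrix.mulVec, dotProduct, sum_mul, mul_sum]
  rw [sum_comm]
  refine sum_congr rfl fun a _ => sum_congr rfl fun b _ => ?_
  linear_combination (f a * g b) * h b a

/-- For `c = 1` and `c = -1` these are the quadratic forms of `I + P` and `I - P` as sums of
squares; they place the spectrum of the lazy chain in `[0, 1]`. -/
lemma weightedInner_mulVec_add (hP : P ∈ Matrix.rowStochastic ℝ V)
    (hπ : IsStationaryDistribution P π) (f : V → ℝ) (c : ℝ) (hc : c * c = 1) :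
    2 * (weightedInner π f f + c * weightedInner π f (P *ᵥ f)) =
      ∑ a, ∑ b, π a * P a b * (f a + c * f b) ^ 2 := by
  have h1 : ∑ a, ∑ b, π a * P a b * (f a * f a) = weightedInner π f f := by
    refine sum_congr rfl fun a _ => ?_
    rw [← sum_mul, ← mul_sum, Matrix.sum_row_of_mem_rowStochastic hP]; ring
  have h2 : ∑ a, ∑ b, π a * P a b * (f b * f b) = weightedInner π f f := by
    rw [sum_comm]
    refine sum_congr rfl fun b _ => ?_
    rw [← sum_mul]
    congr 1
    exact congrFun hπ.stationary b
  have h3 : ∑ a, ∑ b, π a * P a b * (f a * f b) = weightedInner π f (P *ᵥ f) := by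
    refine sum_congr rfl fun a _ => ?_
    simp only [Matrix.mulVec, dotProduct, mul_sum]
    exact sum_congr rfl fun b _ => by ring
  calc _ = ∑ a, ∑ b, π a * P a b * (f a * f a) + 2 * c * ∑ a, ∑ b, π a * P a b * (f a * f b)
        + c * c * ∑ a, ∑ b, π a * P a b * (f b * f b) := by rw [h1, h2, h3, hc]; ring
    _ = _ := by
      simp only [mul_sum, ← sum_add_distrib]
      exact sum_congr rfl fun a _ => sum_congr rfl fun b _ => by ring

lemma lazyMatrix_mem_rowStochastic (hP : P ∈ Matrix.rowStochastic ℝ V) :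
    lazyMatrix P ∈ Matrix.rowStochastic ℝ V := by
  have := Matrix.convex_rowStochastic hP (one_mem (Matrix.rowStochastic ℝ V))
    (show (0 : ℝ) ≤ 1 / 2 by norm_num) (show (0 : ℝ) ≤ 1 / 2 by norm_num) (by norm_num)
  rwa [← smul_add] at this

lemma lazyMatrix_mulVec (f : V → ℝ) : lazyMatrix P *ᵥ f = (1 / 2 : ℝ) • (P *ᵥ f + f) := by
  simp [lazyMatrix, Matrix.smul_mulVec, Matrix.add_mulVec]

lemma vecMul_lazyMatrix (v : V → ℝ) : v ᵥ* lazyMatrix P = (1 / 2 : ℝ) • (v ᵥ* P + v) := by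
  simp [lazyMatrix, Matrix.vecMul_smul, Matrix.vecMul_add]

theorem IsReversibleChain.isPositiveChain_lazyMatrix (h : IsReversibleChain P π) :
    IsPositiveChain (lazyMatrix P) π := by
  have hlin (f g : V → ℝ) : weightedInner π f (lazyMatrix P *ᵥ g) =
      1 / 2 * (weightedInner π f (P *ᵥ g) + weightedInner π f g) := by
    rw [lazyMatrix_mulVec]
    simp only [weightedInner, mul_sum, ← sum_add_distrib, Pi.smul_apply, Pi.add_apply, smul_eq_mul]
    exact sum_congr rfl fun y _ => by ring
  have hsq (f : V → ℝ) (c : ℝ) : 0 ≤ ∑ a, ∑ b, π a * P a b * (f a + c * f b) ^ 2 :=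
    sum_nonneg fun a _ => sum_nonneg fun b _ => mul_nonneg
      (mul_nonneg (h.stationary.nonneg a) (h.stochastic.1 a b)) (sq_nonneg _)
  refine ⟨lazyMatrix_mem_rowStochastic h.stochastic,
    ⟨h.stationary.nonneg, h.stationary.sum_eq_one, ?_⟩, fun f g => ?_, fun f => ?_, fun f => ?_⟩
  · rw [vecMul_lazyMatrix, h.stationary.stationary, ← two_smul ℝ, smul_smul]; norm_num
  · rw [weightedInner_comm, hlin, hlin, weightedInner_comm g, weightedInner_comm g,
      weightedInner_mulVec_comm h.reversible]
  · have := hsq f 1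
    rw [← weightedInner_mulVec_add h.stochastic h.stationary f 1 (by norm_num)] at this
    rw [hlin]; linarith
  · have := hsq f (-1)
    rw [← weightedInner_mulVec_add h.stochastic h.stationary f (-1) (by norm_num)] at this
    rw [hlin]; linarith

namespace IsPositiveChain

lemma inner_pow_pow (hQ : IsPositiveChain Q π) (f h : V → ℝ) (m n : ℕ) :
    weightedInner π (Q ^ m *ᵥ f) (Q ^ n *ᵥ h) = weightedInner π f (Q ^ (m + n) *ᵥ h) := by
  induction m generalizing n with
  | zero => simp
  | succ m ih =>
    rw [pow_succ', ← Matrix.mulVec_mulVec, hQ.symm, Matrix.mulVec_mulVec, ← pow_succ', ih]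
    congr 3; lia

lemma inner_pow_nonneg (hQ : IsPositiveChain Q π) (f : V → ℝ) (n : ℕ) :
    0 ≤ weightedInner π f (Q ^ n *ᵥ f) := by
  obtain ⟨k, rfl | rfl⟩ := Nat.even_or_odd' n
  · rw [two_mul, ← hQ.inner_pow_pow]
    exact weightedInner_self_nonneg hQ.stationary.nonneg _
  · have := hQ.inner_nonneg (Q ^ k *ᵥ f)
    rw [Matrix.mulVec_mulVec, ← pow_succ', hQ.inner_pow_pow] at this
    rwa [show 2 * k + 1 = k + (k + 1) by lia]

lemma inner_pow_drop_even (hQ : IsPositiveChain Q π) (f : V → ℝ) (k : ℕ) :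
    weightedInner π f (Q ^ (2 * k + 1) *ᵥ f) ≤ weightedInner π f (Q ^ (2 * k) *ᵥ f) := by
  have := hQ.inner_le (Q ^ k *ᵥ f)
  rw [Matrix.mulVec_mulVec, ← pow_succ', hQ.inner_pow_pow, hQ.inner_pow_pow] at this
  rwa [show 2 * k + 1 = k + (k + 1) by lia, two_mul]

/-- Positivity of `Q` tested on the increment `Q^(k+1) f - Q^k f`. -/
lemma inner_pow_convex_odd (hQ : IsPositiveChain Q π) (f : V → ℝ) (k : ℕ) :
    2 * weightedInner π f (Q ^ (2 * k + 2) *ᵥ f) ≤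
      weightedInner π f (Q ^ (2 * k + 1) *ᵥ f) + weightedInner π f (Q ^ (2 * k + 3) *ᵥ f) := by
  have := hQ.inner_nonneg (Q ^ (k + 1) *ᵥ f - Q ^ k *ᵥ f)
  rw [Matrix.mulVec_sub, Matrix.mulVec_mulVec, Matrix.mulVec_mulVec, ← pow_succ', ← pow_succ',
    weightedInner_sub_left, weightedInner_sub_right, weightedInner_sub_right] at this
  simp only [hQ.inner_pow_pow] at this
  rw [show k + 1 + (k + 1 + 1) = 2 * k + 3 by lia, show k + 1 + (k + 1) = 2 * k + 2 by lia,
    show k + (k + 1 + 1) = 2 * k + 2 by lia, show k + (k + 1) = 2 * k + 1 by lia] at this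
  linarith

lemma inner_increment (hQ : IsPositiveChain Q π) (f : V → ℝ) (k : ℕ) :
    weightedInner π (Q ^ (k + 1) *ᵥ f - Q ^ k *ᵥ f) (Q ^ (k + 1) *ᵥ f - Q ^ k *ᵥ f) =
      weightedInner π f (Q ^ (2 * k) *ᵥ f) - 2 * weightedInner π f (Q ^ (2 * k + 1) *ᵥ f) +
        weightedInner π f (Q ^ (2 * k + 2) *ᵥ f) := by
  rw [weightedInner_sub_left, weightedInner_sub_right, weightedInner_sub_right]
  simp only [hQ.inner_pow_pow]
  rw [show k + 1 + (k + 1) = 2 * k + 2 by lia, show k + 1 + k = 2 * k + 1 by lia,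
    show k + (k + 1) = 2 * k + 1 by lia, show k + k = 2 * k by lia]
  ring

lemma inner_pow_antitone (hQ : IsPositiveChain Q π) (f : V → ℝ) :
    Antitone fun n => weightedInner π f (Q ^ n *ᵥ f) := by
  refine antitone_nat_of_succ_le fun n => ?_
  obtain ⟨k, rfl | rfl⟩ := Nat.even_or_odd' n
  · exact hQ.inner_pow_drop_even f k
  · have h1 := hQ.inner_pow_drop_even f (k + 1)
    have h2 := hQ.inner_pow_convex_odd f k
    rw [show 2 * (k + 1) + 1 = 2 * k + 3 by lia, show 2 * (k + 1) = 2 * k + 2 by lia] at h1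
    simp only [add_assoc]
    norm_num
    linarith

/-- A square function estimate of Littlewood-Paley type. -/
lemma sum_inner_increment_le (hQ : IsPositiveChain Q π) (f : V → ℝ) (N : ℕ) :
    ∑ k ∈ range N, (k + 1 : ℝ) *
      weightedInner π (Q ^ (k + 1) *ᵥ f - Q ^ k *ᵥ f) (Q ^ (k + 1) *ᵥ f - Q ^ k *ᵥ f) ≤
    weightedInner π f f := by
  set a : ℕ → ℝ := fun n => weightedInner π f (Q ^ n *ᵥ f) with ha
  have hanti : Antitone a := hQ.inner_pow_antitone f
  -- The boundary terms make the induction close: the sum is a second-order summation by parts for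
  -- the sequence `a`, with convexity at odd indices moving the weight forward.
  have key : ∑ k ∈ range N, (k + 1 : ℝ) *
      weightedInner π (Q ^ (k + 1) *ᵥ f - Q ^ k *ᵥ f) (Q ^ (k + 1) *ᵥ f - Q ^ k *ᵥ f) ≤
      a 0 - a (2 * N) - N * (a (2 * N) - a (2 * N + 1)) := by
    induction N with
    | zero => simp
    | succ N ih =>
      rw [sum_range_succ, hQ.inner_increment]
      have h1 : 2 * a (2 * N + 2) ≤ a (2 * N + 1) + a (2 * N + 3) := hQ.inner_pow_convex_odd f N
      have h2 : a (2 * N + 2) ≤ a (2 * N + 1) := hanti (by lia)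
      have h3 : (N + 1 : ℝ) * (2 * a (2 * N + 2)) ≤
          (N + 1 : ℝ) * (a (2 * N + 1) + a (2 * N + 3)) := by gcongr
      change _ + (N + 1 : ℝ) * (a (2 * N) - 2 * a (2 * N + 1) + a (2 * N + 2)) ≤ _
      rw [show 2 * (N + 1) = 2 * N + 2 by lia, show 2 * N + 2 + 1 = 2 * N + 3 by lia]
      push_cast
      linarith
  have h0 : a 0 = weightedInner π f f := by simp [ha]
  have h1 : 0 ≤ a (2 * N) := hQ.inner_pow_nonneg f _
  have h2 : a (2 * N + 1) ≤ a (2 * N) := hanti (by lia)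
  have h3 : 0 ≤ (N : ℝ) * (a (2 * N) - a (2 * N + 1)) :=
    mul_nonneg (Nat.cast_nonneg _) (by linarith)
  linarith

end IsPositiveChain

/-! ### Decay of centred functions and of total variation -/

lemma abs_mulVec_le (hQ : Q ∈ Matrix.rowStochastic ℝ V) {f : V → ℝ} {B : ℝ}
    (hf : ∀ y, |f y| ≤ B) (y : V) : |(Q *ᵥ f) y| ≤ B := by
  calc |(Q *ᵥ f) y| ≤ ∑ z, |Q y z * f z| := abs_sum_le_sum_abs _ _
    _ ≤ ∑ z, Q y z * B := by
      refine sum_le_sum fun z _ => ?_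
      rw [abs_mul, abs_of_nonneg (hQ.1 y z)]
      exact mul_le_mul_of_nonneg_left (hf z) (hQ.1 y z)
    _ = B := by rw [← sum_mul, Matrix.sum_row_of_mem_rowStochastic hQ, one_mul]

lemma IsStationaryDistribution.dotProduct_pow_mulVec (hπ : IsStationaryDistribution Q π)
    (f : V → ℝ) (n : ℕ) : π ⬝ᵥ (Q ^ n *ᵥ f) = π ⬝ᵥ f := by
  induction n with
  | zero => simp
  | succ n ih => rw [pow_succ', ← Matrix.mulVec_mulVec, Matrix.dotProduct_mulVec, hπ.stationary, ih]

lemma abs_dotProduct_le {v f : V → ℝ} {B : ℝ} (hv : ∀ y, 0 ≤ v y) (hf : ∀ y, |f y| ≤ B) :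
    |v ⬝ᵥ f| ≤ (∑ y, v y) * B := by
  rw [sum_mul]
  refine (abs_sum_le_sum_abs _ _).trans (sum_le_sum fun y _ => ?_)
  rw [abs_mul, abs_of_nonneg (hv y)]
  exact mul_le_mul_of_nonneg_left (hf y) (hv y)

/-- Sums of a centred function along the chain are controlled by an occupation vector. -/
lemma IsOccupation.abs_sum_pow_mulVec_le {G : V → ℝ} (hG : IsOccupation Q π x G)
    (hQ : Q ∈ Matrix.rowStochastic ℝ V) (hπ : IsStationaryDistribution Q π) {f : V → ℝ} {B : ℝ}
    (hf : ∀ y, |f y| ≤ B) (hf0 : π ⬝ᵥ f = 0) (s : ℕ) :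
    |∑ k ∈ range s, (Q ^ k *ᵥ f) x| ≤ (∑ y, G y) * (2 * B) := by
  have h1 (k : ℕ) : (Q ^ k *ᵥ f) x = G ⬝ᵥ (Q ^ k *ᵥ f) - G ⬝ᵥ (Q ^ (k + 1) *ᵥ f) := by
    have h := congrArg (fun v => v ⬝ᵥ (Q ^ k *ᵥ f)) hG.balance
    simp only [add_dotProduct, hπ.dotProduct_pow_mulVec, hf0, single_one_dotProduct,
      ← Matrix.dotProduct_mulVec, Matrix.mulVec_mulVec, ← pow_succ'] at h
    linarith
  have h2 : ∑ k ∈ range s, (Q ^ k *ᵥ f) x = G ⬝ᵥ (f - Q ^ s *ᵥ f) := by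
    simp only [h1]
    rw [sum_range_sub' (fun k => G ⬝ᵥ (Q ^ k *ᵥ f))]
    simp [dotProduct_sub]
  rw [h2]
  refine abs_dotProduct_le hG.nonneg fun y => ?_
  have := abs_mulVec_le (pow_mem hQ s) hf y
  have := hf y
  rw [Pi.sub_apply]
  exact (abs_sub _ _).trans (by linarith)

lemma IsPositiveChain.inner_pow_le (hQ : IsPositiveChain Q π) {T B : ℝ}
    (hG : ∀ x, ∃ G, IsOccupation Q π x G ∧ ∑ y, G y ≤ T) {f : V → ℝ}
    (hB : 0 ≤ B) (hf : ∀ y, |f y| ≤ B) (hf0 : π ⬝ᵥ f = 0) (n : ℕ) :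
    n * weightedInner π f (Q ^ n *ᵥ f) ≤ 2 * T * B ^ 2 := by
  -- Monotonicity bounds the last term by the average, and the sum is controlled pointwise by
  -- occupation vectors.
  have h1 : n * weightedInner π f (Q ^ n *ᵥ f) ≤
      ∑ k ∈ range n, weightedInner π f (Q ^ k *ᵥ f) := by
    have := card_nsmul_le_sum (range n) (fun k => weightedInner π f (Q ^ k *ᵥ f))
      (weightedInner π f (Q ^ n *ᵥ f))
      fun k hk => hQ.inner_pow_antitone f (mem_range.1 hk).le
    simpa using this
  refine h1.trans ?_
  simp only [weightedInner]
  rw [sum_comm]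
  calc _ ≤ ∑ y, π y * (2 * T * B ^ 2) := by
        refine sum_le_sum fun y _ => ?_
        simp only [← mul_sum]
        refine mul_le_mul_of_nonneg_left ?_ (hQ.stationary.nonneg y)
        obtain ⟨G, hG, hT⟩ := hG y
        have h2 := hG.abs_sum_pow_mulVec_le hQ.stochastic hQ.stationary hf hf0 n
        calc _ ≤ |f y| * |∑ k ∈ range n, (Q ^ k *ᵥ f) y| := by rw [← abs_mul]; exact le_abs_self _
          _ ≤ B * (T * (2 * B)) := by
            gcongr
            · exact hf y
            · exact h2.trans (by gcongr)
          _ = _ := by ring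
    _ = _ := by rw [← sum_mul, hQ.stationary.sum_eq_one, one_mul]

lemma mul_sub_sum_range (u : ℕ → ℝ) (s : ℕ) :
    s * u s - ∑ k ∈ range s, u k = ∑ k ∈ range s, (k + 1 : ℝ) * (u (k + 1) - u k) := by
  induction s with
  | zero => simp
  | succ s ih => rw [sum_range_succ, sum_range_succ, ← ih]; push_cast; ring

/-- Cauchy–Schwarz with weights `k + 1`; the right-hand sum runs to `N` so that one square function
serves every `s ≤ N`. -/
lemma sq_mul_sub_sum_range_le (u : ℕ → ℝ) {s N : ℕ} (hsN : s ≤ N) :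
    (s * u s - ∑ k ∈ range s, u k) ^ 2 ≤
      s ^ 2 * ∑ k ∈ range N, (k + 1 : ℝ) * (u (k + 1) - u k) ^ 2 := by
  rw [mul_sub_sum_range]
  have h1 : (∑ k ∈ range s, (k + 1 : ℝ) * (u (k + 1) - u k)) ^ 2 ≤
      (∑ k ∈ range s, (k + 1 : ℝ)) * ∑ k ∈ range s, (k + 1 : ℝ) * (u (k + 1) - u k) ^ 2 :=
    sum_sq_le_sum_mul_sum_of_sq_le_mul _ (fun k _ => by positivity) (fun k _ => by positivity)
      fun k _ => le_of_eq (by ring)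
  have h2 : ∑ k ∈ range s, (k + 1 : ℝ) ≤ s ^ 2 := by
    have := sum_le_card_nsmul (range s) (fun k : ℕ => (k + 1 : ℝ)) s fun k hk => by
      exact_mod_cast mem_range.1 hk
    simpa [sq] using this
  refine h1.trans (mul_le_mul h2 ?_ (sum_nonneg fun k _ => by positivity) (by positivity))
  exact sum_le_sum_of_subset_of_nonneg (range_mono hsN) fun k _ _ => by positivity

/-- Compare `u s` with its average. The AM-GM parameter `η` replaces the square root of the square
function by a linear expression, easy to integrate. -/
lemma abs_le_of_sum_range_bound (u : ℕ → ℝ) {s N : ℕ} (hs : 0 < s) (hsN : s ≤ N) {B η : ℝ}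
    (hη : 0 < η) (hB : |∑ k ∈ range s, u k| ≤ B) :
    |u s| ≤ B / s + (∑ k ∈ range N, (k + 1 : ℝ) * (u (k + 1) - u k) ^ 2) / (2 * η) + η / 2 := by
  have hs' : (0 : ℝ) < s := by exact_mod_cast hs
  set A := ∑ k ∈ range N, (k + 1 : ℝ) * (u (k + 1) - u k) ^ 2
  set d := u s - (∑ k ∈ range s, u k) / s with hd
  have h1 : d ^ 2 ≤ A := by
    have h := sq_mul_sub_sum_range_le u hsN
    have : s * u s - ∑ k ∈ range s, u k = s * d := by rw [hd]; field_simp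
    rw [this, mul_pow] at h
    exact le_of_mul_le_mul_left h (by positivity)
  have h2 : |d| ≤ A / (2 * η) + η / 2 := by
    have h3 : 2 * η * |d| ≤ A + η ^ 2 := by nlinarith [sq_nonneg (|d| - η), sq_abs d]
    have h4 : A / (2 * η) + η / 2 = (A + η ^ 2) / (2 * η) := by field_simp
    rw [h4, le_div_iff₀ (by positivity)]
    linarith
  have h3 : u s = (∑ k ∈ range s, u k) / s + d := by rw [hd]; ring
  have h4 : |(∑ k ∈ range s, u k) / s| ≤ B / s := by
    rw [abs_div, abs_of_pos hs']
    gcongr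
  rw [h3]
  exact (abs_add_le _ _).trans (by linarith)

/-- A maximal inequality, uniform in time, for centred functions. -/
lemma IsPositiveChain.exists_maximal_bound (hQ : IsPositiveChain Q π) {T B η : ℝ}
    (hG : ∀ x, ∃ G, IsOccupation Q π x G ∧ ∑ y, G y ≤ T) {f : V → ℝ}
    (hB : 0 ≤ B) (hf : ∀ y, |f y| ≤ B) (hf0 : π ⬝ᵥ f = 0) (hη : 0 < η) {r : ℕ} (hr : 0 < r)
    (N : ℕ) :
    ∃ M : V → ℝ, (∀ n y, 2 * r ≤ n → n ≤ N → |(Q ^ n *ᵥ f) y| ≤ M y) ∧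
      ∑ y, π y * M y ≤ 2 * T * B / r + T * B ^ 2 / (2 * r * η) + η / 2 := by
  have hr' : (0 : ℝ) < r := by exact_mod_cast hr
  -- The first `r` steps make the `L²(π)` norm small; the next `s ≥ r` steps make the average of
  -- length `s` small.
  set h := Q ^ r *ᵥ f with hh
  set A : V → ℝ := fun y => ∑ k ∈ range N, (k + 1 : ℝ) * ((Q ^ (k + 1) *ᵥ h) y - (Q ^ k *ᵥ h) y) ^ 2
    with hA
  refine ⟨fun y => 2 * T * B / r + A y / (2 * η) + η / 2, fun n y h1 h2 => ?_, ?_⟩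
  · obtain ⟨s, rfl⟩ : ∃ s, n = s + r := ⟨n - r, by lia⟩
    have hT : 0 ≤ T := by
      obtain ⟨G, hG, hGT⟩ := hG y
      exact (sum_nonneg fun y _ => hG.nonneg y).trans hGT
    have h3 : |∑ k ∈ range s, (Q ^ k *ᵥ h) y| ≤ 2 * T * B := by
      have h4 : ∑ k ∈ range s, (Q ^ k *ᵥ h) y =
          (Q ^ r *ᵥ (fun z => ∑ k ∈ range s, (Q ^ k *ᵥ f) z)) y := by
        have : (fun z => ∑ k ∈ range s, (Q ^ k *ᵥ f) z) = ∑ k ∈ range s, Q ^ k *ᵥ f := by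
          ext z; simp
        rw [this, Matrix.mulVec_sum, Finset.sum_apply]
        refine sum_congr rfl fun k _ => ?_
        rw [hh, Matrix.mulVec_mulVec, Matrix.mulVec_mulVec, ← pow_add, ← pow_add, add_comm]
      rw [h4]
      refine abs_mulVec_le (pow_mem hQ.stochastic r) (fun z => ?_) y
      obtain ⟨G, hG, hGT⟩ := hG z
      refine (hG.abs_sum_pow_mulVec_le hQ.stochastic hQ.stationary hf hf0 s).trans ?_
      calc _ ≤ T * (2 * B) := by gcongr
        _ = _ := by ring
    have h5 := abs_le_of_sum_range_bound (fun k => (Q ^ k *ᵥ h) y) (s := s) (N := N)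
      (by lia) (by lia) hη h3
    have h6 : (Q ^ s *ᵥ h) y = (Q ^ (s + r) *ᵥ f) y := by
      rw [hh, Matrix.mulVec_mulVec, ← pow_add]
    have h7 : 2 * T * B / s ≤ 2 * T * B / r := by
      have : (r : ℝ) ≤ s := by exact_mod_cast (show r ≤ s by lia)
      gcongr
    simp only [h6] at h5
    linarith
  · have h1 : ∑ y, π y * A y ≤ T * B ^ 2 / r := by
      have h2 : ∑ y, π y * A y ≤ weightedInner π h h := by
        refine le_trans (le_of_eq ?_) (hQ.sum_inner_increment_le h N)
        simp only [hA, weightedInner, mul_sum]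
        rw [sum_comm]
        refine sum_congr rfl fun k _ => sum_congr rfl fun y _ => ?_
        simp only [Pi.sub_apply]
        ring
      -- The squared norm of `h` is the pairing of `f` with `Q^(2r) f`.
      have h3 := hQ.inner_pow_le hG hB hf hf0 (r + r)
      rw [← hQ.inner_pow_pow, ← hh] at h3
      rw [le_div_iff₀ hr']
      push_cast at h3
      nlinarith
    have h2 : ∑ y, π y * (2 * T * B / r + A y / (2 * η) + η / 2) =
        2 * T * B / r + (∑ y, π y * A y) / (2 * η) + η / 2 := by
      simp only [mul_add, sum_add_distrib, ← sum_mul, hQ.stationary.sum_eq_one, one_mul, sum_div,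
        mul_div_assoc]
    rw [h2]
    have h3 : T * B ^ 2 / (2 * r * η) = T * B ^ 2 / r / (2 * η) := by field_simp
    rw [h3]
    gcongr

/-- Condition on where the flow has stopped by time `n`; the chain keeps running after it stops. -/
lemma IsStoppingFlow.pow_mulVec_eq {s g : ℕ → V → ℝ} (h : IsStoppingFlow Q π x s g) (f : V → ℝ)
    {n t : ℕ} (hn : n ≤ t) :
    (Q ^ t *ᵥ f) x = ∑ k ∈ range (n + 1), s k ⬝ᵥ (Q ^ (t - k) *ᵥ f) +
      g n ⬝ᵥ (Q ^ (t - n) *ᵥ f) := by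
  induction n with
  | zero =>
    rw [zero_add, sum_range_one, ← add_dotProduct, h.init]
    simp
  | succ n ih =>
    rw [ih (by lia), sum_range_succ _ (n + 1), add_assoc, ← add_dotProduct, h.step,
      ← Matrix.dotProduct_mulVec, Matrix.mulVec_mulVec, ← pow_succ']
    congr 5; lia

lemma IsStoppingFlow.sum_go_add {s g : ℕ → V → ℝ} (h : IsStoppingFlow Q π x s g)
    (hQ : Q ∈ Matrix.rowStochastic ℝ V) (n : ℕ) :
    ∑ y, s (n + 1) y + ∑ y, g (n + 1) y = ∑ y, g n y := by
  rw [← sum_vecMul_of_mem_rowStochastic hQ (g n), ← h.step, ← sum_add_distrib]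
  rfl

lemma IsStoppingFlow.sum_go_antitone {s g : ℕ → V → ℝ} (h : IsStoppingFlow Q π x s g)
    (hQ : Q ∈ Matrix.rowStochastic ℝ V) : Antitone fun n => ∑ y, g n y :=
  antitone_nat_of_succ_le fun n => by
    have := h.sum_go_add hQ n
    have := sum_nonneg fun y (_ : y ∈ univ) => h.stop_nonneg (n + 1) y
    linarith

/-- If every state has an occupation vector of total mass at most `T`, then centred functions
decay in time of order `T`. -/
theorem IsPositiveChain.abs_pow_mulVec_le (hQ : IsPositiveChain Q π) {T B η : ℝ}
    (hG : ∀ x, ∃ G, IsOccupation Q π x G ∧ ∑ y, G y ≤ T) {f : V → ℝ}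
    (hB : 0 ≤ B) (hf : ∀ y, |f y| ≤ B) (hf0 : π ⬝ᵥ f = 0) (hη : 0 < η) {r : ℕ} (hr : 0 < r)
    (x : V) :
    |(Q ^ (3 * r) *ᵥ f) x| ≤ 3 * T * B / r + T * B ^ 2 / (2 * r * η) + η / 2 := by
  have hr' : (0 : ℝ) < r := by exact_mod_cast hr
  obtain ⟨M, hM, hMπ⟩ := hQ.exists_maximal_bound hG hB hf hf0 hη hr (3 * r)
  obtain ⟨G, hGx, hGT⟩ := hG x
  obtain ⟨s, g, hsg, hg⟩ := exists_isStoppingFlow hQ.stochastic hQ.stationary.nonneg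
    hQ.stationary.sum_eq_one hGx
  rw [hsg.pow_mulVec_eq f (n := r - 1) (t := 3 * r) (by lia), show r - 1 + 1 = r by lia]
  have h1 : |∑ k ∈ range r, s k ⬝ᵥ (Q ^ (3 * r - k) *ᵥ f)| ≤ ∑ y, π y * M y := by
    calc _ ≤ ∑ k ∈ range r, ∑ y, s k y * M y := by
          refine (abs_sum_le_sum_abs _ _).trans (sum_le_sum fun k hk => ?_)
          refine (abs_sum_le_sum_abs _ _).trans (sum_le_sum fun y _ => ?_)
          rw [abs_mul, abs_of_nonneg (hsg.stop_nonneg k y)]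
          have := mem_range.1 hk
          exact mul_le_mul_of_nonneg_left (hM _ y (by lia) (by lia)) (hsg.stop_nonneg k y)
      _ ≤ _ := by
          rw [sum_comm]
          refine sum_le_sum fun y _ => ?_
          rw [← sum_mul]
          refine mul_le_mul_of_nonneg_right ?_ ((abs_nonneg _).trans (hM (2 * r) y le_rfl (by lia)))
          exact sum_le_hasSum _ (fun k _ => hsg.stop_nonneg k y) (hsg.hasSum y)
  -- Markov's inequality: the moving masses decrease and their sum is at most `T`.
  have h2 : ∑ y, g (r - 1) y ≤ T / r := by
    rw [le_div_iff₀ hr', mul_comm]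
    have := card_nsmul_le_sum (range r) (fun k => ∑ y, g k y) (∑ y, g (r - 1) y)
      fun k hk => hsg.sum_go_antitone hQ.stochastic (by have := mem_range.1 hk; lia)
    rw [card_range, nsmul_eq_mul] at this
    exact this.trans ((hg r).trans hGT)
  have h3 : |g (r - 1) ⬝ᵥ (Q ^ (3 * r - (r - 1)) *ᵥ f)| ≤ T / r * B :=
    (abs_dotProduct_le (hsg.go_nonneg _)
      (abs_mulVec_le (pow_mem hQ.stochastic _) hf)).trans (by gcongr)
  have h4 : T / r * B + 2 * T * B / r = 3 * T * B / r := by ring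
  exact (abs_add_le _ _).trans (by linarith)

lemma sum_abs_le_of_forall_sign {v : V → ℝ} {C : ℝ}
    (h : ∀ φ : V → ℝ, (∀ y, |φ y| ≤ 1) → v ⬝ᵥ φ ≤ C) : ∑ y, |v y| ≤ C := by
  refine le_trans (le_of_eq ?_) (h (fun y => SignType.sign (v y)) fun y => ?_)
  · exact sum_congr rfl fun y _ => (self_mul_sign (v y)).symm
  · rcases lt_trichotomy (v y) 0 with h | h | h <;> simp [h]

theorem IsPositiveChain.tvDist_pow_le (hQ : IsPositiveChain Q π) {T : ℝ}
    (hG : ∀ x, ∃ G, IsOccupation Q π x G ∧ ∑ y, G y ≤ T) {r : ℕ} (hr : 0 < r)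
    (hrT : 40 * T ≤ r) (x : V) : tvDist (fun y => (Q ^ (3 * r)) x y) π ≤ 1 / 4 := by
  have hr' : (0 : ℝ) < r := by exact_mod_cast hr
  suffices ∑ y, |(Q ^ (3 * r)) x y - π y| ≤ 1 / 2 by rw [tvDist]; linarith
  refine sum_abs_le_of_forall_sign (v := fun y => (Q ^ (3 * r)) x y - π y) fun φ hφ => ?_
  have hm : |π ⬝ᵥ φ| ≤ 1 := by
    simpa [hQ.stationary.sum_eq_one] using abs_dotProduct_le hQ.stationary.nonneg hφ
  set f : V → ℝ := fun y => φ y - π ⬝ᵥ φ with hf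
  have hf2 : ∀ y, |f y| ≤ 2 := fun y => (abs_sub _ _).trans (by linarith [hφ y])
  have hf0 : π ⬝ᵥ f = 0 := by
    simp only [hf, dotProduct, mul_sub, sum_sub_distrib, ← sum_mul, hQ.stationary.sum_eq_one]
    ring
  -- Centring a test function bounded by `1` costs a factor `2`. With `η = 1/4` the bound is `14 T/r
  -- + 1/8`, below `1/2` once `r ≥ 40 T`.
  have h1 := hQ.abs_pow_mulVec_le hG (by norm_num) hf2 hf0 (η := 1 / 4) (by norm_num) hr x
  have h2 : (Q ^ (3 * r) *ᵥ f) x = (fun y => (Q ^ (3 * r)) x y - π y) ⬝ᵥ φ := by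
    simp only [Matrix.mulVec, dotProduct, hf, mul_sub, sub_mul, sum_sub_distrib, ← sum_mul,
      Matrix.sum_row_of_mem_rowStochastic (pow_mem hQ.stochastic (3 * r))]
    ring
  rw [← h2]
  refine (le_abs_self _).trans (h1.trans ?_)
  have h3 : T / r ≤ 1 / 40 := by rw [div_le_iff₀ hr']; linarith
  have h4 : 3 * T * 2 / r + T * 2 ^ 2 / (2 * r * (1 / 4)) + 1 / 4 / 2 = 14 * (T / r) + 1 / 8 := by
    field_simp; ring
  rw [h4]
  linarith

end Mixing

/-! ### Regeneration, and both comparisons at the level of occupation vectors -/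

section Minorization

set_option linter.unusedSectionVars false

open scoped Matrix
open Finset Filter Topology

variable {V : Type*} [Fintype V] [DecidableEq V] {P Q : Matrix V V ℝ} {π : V → ℝ} {x : V}

/-- A Doeblin minorization `Q ^ N ≥ c π` yields occupation vectors of total mass `N / c`. -/
theorem exists_isOccupation_of_minorization (hQ : Q ∈ Matrix.rowStochastic ℝ V)
    (hπ1 : ∑ y, π y = 1) {N : ℕ} {c : ℝ} (hc : 0 < c)
    (h : ∀ x y, c * π y ≤ (Q ^ N) x y) (x : V) :
    ∃ G, IsOccupation Q π x G ∧ ∑ y, G y = N / c := by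
  -- Regeneration: after each block of `N` steps a fraction `c` of the mass is removed with law `π`.
  -- `v k` is what survives `k` blocks and `m k` counts visits during the next block.
  set M : Matrix V V ℝ := Matrix.of fun x y => (Q ^ N) x y - c * π y with hM
  set v : ℕ → V → ℝ := fun k => Nat.rec (Pi.single x 1) (fun _ u => u ᵥ* M) k with hv
  set m : ℕ → V → ℝ := fun k => v k ᵥ* ∑ j ∈ range N, Q ^ j with hm
  have hc1 : c ≤ 1 := by
    have : ∑ y, c * π y ≤ ∑ y, (Q ^ N) x y := sum_le_sum fun y _ => h x y
    rwa [← mul_sum, hπ1, mul_one, Matrix.sum_row_of_mem_rowStochastic (pow_mem hQ N)] at this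
  have hv0 (k : ℕ) (y : V) : 0 ≤ v k y := by
    induction k generalizing y with
    | zero => exact single_one_nonneg x y
    | succ k ih => exact sum_nonneg fun z _ => mul_nonneg (ih z) (sub_nonneg.2 (h z y))
  have hstep (k : ℕ) : v (k + 1) = v k ᵥ* Q ^ N - (c * ∑ y, v k y) • π := by
    ext y
    change (v k ᵥ* M) y = _
    simp only [Matrix.vecMul, dotProduct, hM, Matrix.of_apply, mul_sub, sum_sub_distrib,
      Pi.sub_apply, Pi.smul_apply, smul_eq_mul, mul_sum, sum_mul]
    congr 1
    exact sum_congr rfl fun z _ => by ring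
  have hmass (k : ℕ) : ∑ y, v k y = (1 - c) ^ k := by
    induction k with
    | zero => simp [hv]
    | succ k ih =>
      simp only [hstep, Pi.sub_apply, Pi.smul_apply, smul_eq_mul, sum_sub_distrib, ← mul_sum, hπ1,
        sum_vecMul_of_mem_rowStochastic (pow_mem hQ N), ih]
      ring
  have hm0 (k : ℕ) (y : V) : 0 ≤ m k y := by
    simp only [hm, Matrix.vecMul_sum, Finset.sum_apply]
    exact sum_nonneg fun j _ => Matrix.nonneg_vecMul_of_mem_rowStochastic (pow_mem hQ j) (hv0 k) y
  have hmmass (k : ℕ) : ∑ y, m k y = N * (1 - c) ^ k := by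
    simp only [hm, Matrix.vecMul_sum, Finset.sum_apply]
    rw [sum_comm]
    simp [sum_vecMul_of_mem_rowStochastic (pow_mem hQ _), hmass]
  have hgeom : HasSum (fun k : ℕ => (1 - c) ^ k) c⁻¹ := by
    simpa using hasSum_geometric_of_lt_one (sub_nonneg.2 hc1) (by linarith : 1 - c < 1)
  have hvs (y : V) : Summable fun k => v k y :=
    Summable.of_nonneg_of_le (fun k => hv0 k y)
      (fun k => (single_le_sum (fun z _ => hv0 k z) (mem_univ y)).trans (hmass k).le)
      hgeom.summable
  have hms (y : V) : Summable fun k => m k y :=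
    Summable.of_nonneg_of_le (fun k => hm0 k y)
      (fun k => (single_le_sum (fun z _ => hm0 k z) (mem_univ y)).trans (hmmass k).le)
      (hgeom.summable.mul_left _)
  refine ⟨fun y => ∑' k, m k y, ⟨fun y => tsum_nonneg fun k => hm0 k y, ?_⟩, ?_⟩
  -- The balance over one block, in which mass `c (1 - c)^k` is deposited; summing over `k`
  -- telescopes the `v k`.
  · have hbal (k : ℕ) (y : V) :
        (m k ᵥ* Q) y + v k y = m k y + v (k + 1) y + (1 - c) ^ k * (c * π y) := by
      have h1 : m k ᵥ* Q + v k = m k + v k ᵥ* Q ^ N := by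
        have h2 : (∑ j ∈ range N, Q ^ j) * Q + 1 = ∑ j ∈ range N, Q ^ j + Q ^ N := by
          rw [← sum_range_succ, sum_range_succ', sum_mul]
          simp [pow_succ]
        have h3 := congrArg (fun A => v k ᵥ* A) h2
        simpa [Matrix.vecMul_add, ← Matrix.vecMul_vecMul] using h3
      have h2 := congrFun h1 y
      have h3 := congrFun (hstep k) y
      simp only [Pi.add_apply, Pi.sub_apply, Pi.smul_apply, smul_eq_mul, hmass] at h2 h3
      linarith
    ext y
    have hL : HasSum (fun k => (m k ᵥ* Q) y + v k y)
        (((fun z => ∑' k, m k z) ᵥ* Q) y + ∑' k, v k y) := by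
      refine HasSum.add ?_ (hvs y).hasSum
      exact hasSum_sum fun z _ => (hms z).hasSum.mul_right (Q z y)
    have hR : HasSum (fun k => m k y + v (k + 1) y + (1 - c) ^ k * (c * π y))
        (∑' k, m k y + (∑' k, v k y - v 0 y) + c⁻¹ * (c * π y)) := by
      refine ((hms y).hasSum.add ?_).add (hgeom.mul_right _)
      have := (hasSum_nat_add_iff' (f := fun k => v k y) 1).2 (hvs y).hasSum
      simpa using this
    have h1 := hL.unique (by simpa only [hbal] using hR)
    rw [inv_mul_cancel_left₀ hc.ne'] at h1
    simp only [Pi.add_apply]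
    have h2 : v 0 y = (Pi.single x 1 : V → ℝ) y := rfl
    linarith
  · have h1 : HasSum (fun k => ∑ y, m k y) (∑ y, ∑' k, m k y) :=
      hasSum_sum fun y _ => (hms y).hasSum
    simp only [hmmass] at h1
    rw [h1.unique (hgeom.mul_left _), div_eq_mul_inv]

lemma IsOccupation.of_lazyMatrix {G : V → ℝ} (hG : IsOccupation (lazyMatrix P) π x G) :
    IsOccupation P π x ((1 / 2 : ℝ) • G) := by
  refine ⟨fun y => mul_nonneg (by norm_num) (hG.nonneg y), ?_⟩
  ext y
  have h := congrFun hG.balance y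
  rw [vecMul_lazyMatrix] at h
  rw [Matrix.smul_vecMul]
  simp only [Pi.add_apply, Pi.smul_apply, smul_eq_mul] at h ⊢
  linarith

lemma IsOccupation.lazyMatrix {G : V → ℝ} (hG : IsOccupation P π x G) :
    IsOccupation (lazyMatrix P) π x ((2 : ℝ) • G) := by
  refine ⟨fun y => mul_nonneg (by norm_num) (hG.nonneg y), ?_⟩
  ext y
  have h := congrFun hG.balance y
  rw [vecMul_lazyMatrix, Matrix.smul_vecMul]
  simp only [Pi.add_apply, Pi.smul_apply, smul_eq_mul] at h ⊢
  linarith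

lemma IsReversibleChain.pos (h : IsReversibleChain P π) (y : V) : 0 < π y := by
  obtain ⟨a, ha⟩ : ∃ a, 0 < π a := by
    by_contra! hle
    have := sum_nonpos fun y (_ : y ∈ univ) => hle y
    rw [h.stationary.sum_eq_one] at this
    norm_num at this
  obtain ⟨k, -, hk⟩ := (Matrix.isIrreducible_iff_exists_pow_pos h.stochastic.1).1 h.irreducible a y
  have hst : π ᵥ* P ^ k = π := by
    clear hk
    induction k with
    | zero => simp
    | succ k ih => rw [pow_succ, ← Matrix.vecMul_vecMul, ih, h.stationary.stationary]
  rw [← hst]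
  refine (mul_pos ha hk).trans_le (single_le_sum (f := fun z => π z * (P ^ k) z y)
    (fun z _ => mul_nonneg (h.stationary.nonneg z) ?_) (mem_univ a))
  exact (pow_mem h.stochastic k).1 z y

lemma lazyMatrix_reversible (h : ∀ x y, π x * P x y = π y * P y x) (x y : V) :
    π x * lazyMatrix P x y = π y * lazyMatrix P y x := by
  simp only [lazyMatrix, Matrix.smul_apply, Matrix.add_apply, smul_eq_mul, Matrix.one_apply]
  by_cases hxy : x = y
  · subst hxy; rfl
  · rw [if_neg hxy, if_neg (Ne.symm hxy)]
    linear_combination (1 / 2) * h x y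

lemma pow_reversible (h : ∀ x y, π x * Q x y = π y * Q y x) (n : ℕ) (x y : V) :
    π x * (Q ^ n) x y = π y * (Q ^ n) y x := by
  induction n generalizing x y with
  | zero =>
    by_cases hxy : x = y
    · subst hxy; rfl
    · simp [hxy, Ne.symm hxy]
  | succ n ih =>
    rw [pow_succ, Matrix.mul_apply, ← pow_succ, pow_succ', Matrix.mul_apply, mul_sum, mul_sum]
    refine sum_congr rfl fun z _ => ?_
    linear_combination Q z y * ih x z + (Q ^ n) z x * h z y

/-- The separation distance of a reversible chain at time `2t` is controlled by its total variation
distance at time `t`. -/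
lemma le_pow_two_mul_of_tvDist_le (hQ : Q ∈ Matrix.rowStochastic ℝ V)
    (hrev : ∀ x y, π x * Q x y = π y * Q y x) (hpos : ∀ y, 0 < π y) (hπ1 : ∑ y, π y = 1) {t : ℕ}
    (ht : ∀ x, tvDist (fun y => (Q ^ t) x y) π ≤ 1 / 4) (x y : V) :
    1 / 4 * π y ≤ (Q ^ (2 * t)) x y := by
  have hQt := pow_mem hQ t
  set m : V → ℝ := fun z => min ((Q ^ t) x z) ((Q ^ t) y z) with hm
  have hm0 (z : V) : 0 ≤ m z := le_min (hQt.1 x z) (hQt.1 y z)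
  -- Rows `x` and `y` are within total variation `1/2`, so they overlap in mass at least `1/2`.
  have h1 : 1 / 2 ≤ ∑ z, m z := by
    have h2 : ∑ z, |(Q ^ t) x z - (Q ^ t) y z| ≤ 1 := by
      have hx := ht x
      have hy := ht y
      simp only [tvDist] at hx hy
      calc _ ≤ ∑ z, (|(Q ^ t) x z - π z| + |(Q ^ t) y z - π z|) :=
            sum_le_sum fun z _ => by rw [abs_sub_comm ((Q ^ t) y z)]; exact abs_sub_le _ _ _
        _ ≤ 1 := by rw [sum_add_distrib]; linarith
    have h3 : ∑ z, m z = ∑ z, ((Q ^ t) x z + (Q ^ t) y z - |(Q ^ t) x z - (Q ^ t) y z|) / 2 :=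
      sum_congr rfl fun z _ => by
        rw [hm]
        simp only
        rw [min_def]
        split_ifs with hle
        · rw [abs_of_nonpos (by linarith)]; ring
        · rw [abs_of_nonneg (by linarith)]; ring
    rw [h3, ← sum_div, sum_sub_distrib, sum_add_distrib, Matrix.sum_row_of_mem_rowStochastic hQt,
      Matrix.sum_row_of_mem_rowStochastic hQt]
    linarith
  have h2 : (∑ z, m z) ^ 2 ≤ (∑ z, m z ^ 2 / π z) * ∑ z, π z :=
    sum_sq_le_sum_mul_sum_of_sq_le_mul _ (fun z _ => div_nonneg (sq_nonneg _) (hpos z).le)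
      (fun z _ => (hpos z).le) fun z _ => (div_mul_cancel₀ _ (hpos z).ne').ge
  rw [hπ1, mul_one] at h2
  -- Reversibility reverses the second half of a path of length `2t`, so both halves end at the
  -- common midpoint `z`.
  have h3 : π y * ∑ z, m z ^ 2 / π z ≤ (Q ^ (2 * t)) x y := by
    rw [two_mul, pow_add, Matrix.mul_apply, mul_sum]
    refine sum_le_sum fun z _ => ?_
    have h4 : (Q ^ t) z y = π y * (Q ^ t) y z / π z := by
      rw [eq_div_iff (hpos z).ne', mul_comm, pow_reversible hrev]
    rw [h4, mul_div_assoc', mul_div_assoc']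
    refine div_le_div_of_nonneg_right ?_ (hpos z).le
    have h5 : m z ^ 2 ≤ (Q ^ t) x z * (Q ^ t) y z := by
      rw [sq]
      exact mul_le_mul (min_le_left _ _) (min_le_right _ _) (hm0 z) (hQt.1 x z)
    have := mul_le_mul_of_nonneg_left h5 (hpos y).le
    linarith
  have h4 : 1 / 4 ≤ ∑ z, m z ^ 2 / π z := by nlinarith
  have := mul_le_mul_of_nonneg_left h4 (hpos y).le
  linarith

/-- Holding probabilities preserve positive entries, so one exponent beyond all the individual
hitting exponents works. -/
lemma lazyMatrix_pow_pos (hP : P ∈ Matrix.rowStochastic ℝ V) (hirr : P.IsIrreducible) :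
    ∃ N : ℕ, ∀ x y, 0 < (lazyMatrix P ^ N) x y := by
  have hQ := lazyMatrix_mem_rowStochastic hP
  have hle (x y : V) : 1 / 2 * P x y ≤ lazyMatrix P x y := by
    simp only [lazyMatrix, Matrix.smul_apply, Matrix.add_apply, smul_eq_mul, Matrix.one_apply]
    split_ifs <;> linarith
  have hdiag (y : V) : 0 < lazyMatrix P y y := by
    simp only [lazyMatrix, Matrix.smul_apply, Matrix.add_apply, smul_eq_mul, Matrix.one_apply_eq]
    linarith [hP.1 y y]
  have hpow (k : ℕ) (x y : V) : (1 / 2) ^ k * (P ^ k) x y ≤ (lazyMatrix P ^ k) x y := by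
    induction k generalizing y with
    | zero => simp
    | succ k ih =>
      rw [pow_succ P, pow_succ (lazyMatrix P), Matrix.mul_apply, Matrix.mul_apply, mul_sum]
      refine sum_le_sum fun z _ => ?_
      calc _ = ((1 / 2) ^ k * (P ^ k) x z) * (1 / 2 * P z y) := by ring
        _ ≤ _ := mul_le_mul (ih z) (hle z y) (mul_nonneg (by norm_num) (hP.1 z y))
          ((pow_mem hQ k).1 x z)
  have hsucc (k : ℕ) (x y : V) (h : 0 < (lazyMatrix P ^ k) x y) :
      0 < (lazyMatrix P ^ (k + 1)) x y := by
    rw [pow_succ, Matrix.mul_apply]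
    refine (mul_pos h (hdiag y)).trans_le (single_le_sum
      (f := fun z => (lazyMatrix P ^ k) x z * lazyMatrix P z y)
      (fun z _ => mul_nonneg ((pow_mem hQ k).1 x z) (hQ.1 z y)) (mem_univ y))
  have hex (x y : V) : ∃ k, 0 < (lazyMatrix P ^ k) x y := by
    obtain ⟨k, -, hk⟩ := (Matrix.isIrreducible_iff_exists_pow_pos hP.1).1 hirr x y
    exact ⟨k, (mul_pos (by positivity) hk).trans_le (hpow k x y)⟩
  choose K hK using hex
  refine ⟨∑ x, ∑ y, K x y, fun x y => ?_⟩
  have h1 : K x y ≤ ∑ x, ∑ y, K x y :=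
    (single_le_sum (f := fun y => K x y) (fun _ _ => Nat.zero_le _) (mem_univ y)).trans
      (single_le_sum (f := fun x => ∑ y, K x y) (fun _ _ => Nat.zero_le _) (mem_univ x))
  exact Nat.le_induction (hK x y) (fun n _ hn => hsucc n x y hn) _ h1

lemma IsReversibleChain.exists_isOccupation_lazyMatrix (h : IsReversibleChain P π) (x : V) :
    ∃ G, IsOccupation (_root_.lazyMatrix P) π x G := by
  obtain ⟨N, hN⟩ := lazyMatrix_pow_pos h.stochastic h.irreducible
  obtain ⟨p, -, hp⟩ := (univ : Finset (V × V)).exists_min_image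
    (fun p => (_root_.lazyMatrix P ^ N) p.1 p.2) ⟨(x, x), mem_univ _⟩
  have hmin (a b : V) : (_root_.lazyMatrix P ^ N) p.1 p.2 * π b ≤ (_root_.lazyMatrix P ^ N) a b := by
    refine le_trans ?_ (hp (a, b) (mem_univ _))
    have : π b ≤ 1 := by
      rw [← h.stationary.sum_eq_one]
      exact single_le_sum (fun y _ => h.stationary.nonneg y) (mem_univ b)
    exact mul_le_of_le_one_right (hN _ _).le this
  obtain ⟨G, hG, -⟩ := exists_isOccupation_of_minorization
    (lazyMatrix_mem_rowStochastic h.stochastic) h.stationary.sum_eq_one (hN p.1 p.2) hmin x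
  exact ⟨G, hG⟩

lemma dLazy_le_iff [Nonempty V] {t : ℕ} {ε : ℝ} :
    dLazy P π t ≤ ε ↔ ∀ x, tvDist (fun y => (lazyMatrix P ^ t) x y) π ≤ ε := by
  refine ⟨fun h x => ?_, fun h => ciSup_le h⟩
  exact (le_ciSup (f := fun x => tvDist (fun y => (lazyMatrix P ^ t) x y) π)
    (Set.finite_range _).bddAbove x).trans h

lemma IsReversibleChain.nonempty (h : IsReversibleChain P π) : Nonempty V := by
  by_contra hV
  rw [not_nonempty_iff] at hV
  simpa using h.stationary.sum_eq_one

/-- Purely qualitative: any finite bound on the occupation masses suffices. It is needed because the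
infimum of an empty set of naturals is `0`. -/
theorem IsReversibleChain.exists_dLazy_le (h : IsReversibleChain P π) :
    ∃ t : ℕ, dLazy P π t ≤ 1 / 4 := by
  have := h.nonempty
  choose G hG using h.exists_isOccupation_lazyMatrix
  set T := ∑ x, ∑ y, G x y
  refine ⟨3 * (⌈40 * T⌉₊ + 1), dLazy_le_iff.2 fun x => ?_⟩
  refine h.isPositiveChain_lazyMatrix.tvDist_pow_le (T := T) (fun x => ⟨G x, hG x, ?_⟩)
    (Nat.succ_pos _) ((Nat.le_ceil _).trans (by push_cast; linarith)) x
  exact single_le_sum (f := fun x => ∑ y, G x y)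
    (fun x _ => sum_nonneg fun y _ => (hG x).nonneg y) (mem_univ x)

/-- Occupation vectors of the chain itself are at most four times the lazy mixing time. -/
theorem IsReversibleChain.exists_isOccupation (h : IsReversibleChain P π) (x : V) :
    ∃ G, IsOccupation P π x G ∧ ∑ y, G y = 4 * tLazy P π (1 / 4) := by
  have := h.nonempty
  have ht : dLazy P π (tLazy P π (1 / 4)) ≤ 1 / 4 := Nat.sInf_mem h.exists_dLazy_le
  -- Block length `2t` and `c = 1/4` give mass `8t`, halved on return to `P`.
  obtain ⟨G, hG, hGs⟩ := exists_isOccupation_of_minorization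
    (lazyMatrix_mem_rowStochastic h.stochastic) h.stationary.sum_eq_one (by norm_num)
    (le_pow_two_mul_of_tvDist_le (lazyMatrix_mem_rowStochastic h.stochastic)
      (lazyMatrix_reversible h.reversible) h.pos h.stationary.sum_eq_one (dLazy_le_iff.1 ht)) x
  refine ⟨_, hG.of_lazyMatrix, ?_⟩
  simp only [Pi.smul_apply, smul_eq_mul, ← mul_sum, hGs]
  push_cast
  ring

/-- The lazy mixing time is at most of the order of the total mass of occupation vectors. -/
theorem IsReversibleChain.tLazy_le (h : IsReversibleChain P π) {T : ℝ}
    (hG : ∀ x, ∃ G, IsOccupation P π x G ∧ ∑ y, G y ≤ T) :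
    (tLazy P π (1 / 4) : ℝ) ≤ 264 * T := by
  have := h.nonempty
  have hT0 : 0 ≤ T := by
    obtain ⟨G, hG, hGT⟩ := hG (Classical.arbitrary V)
    exact (sum_nonneg fun y _ => hG.nonneg y).trans hGT
  by_cases h0 : dLazy P π 0 ≤ 1 / 4
  · have : tLazy P π (1 / 4) = 0 := Nat.sInf_eq_zero.2 (Or.inl h0)
    rw [this]
    simpa using hT0
  -- A lower bound on `T` absorbs the rounding in `r`. The balance at `x` gives `1 - π x ≤ G x`, and
  -- `1 - π x` is the distance at time zero.
  have hT : 1 / 4 ≤ T := by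
    by_contra! hlt
    refine h0 (dLazy_le_iff.2 fun x => ?_)
    obtain ⟨G, hG, hGT⟩ := hG x
    have h1 := congrFun hG.balance x
    have h2 := Matrix.nonneg_vecMul_of_mem_rowStochastic h.stochastic hG.nonneg x
    have h3 : G x ≤ ∑ y, G y := single_le_sum (fun y _ => hG.nonneg y) (mem_univ x)
    simp only [Pi.add_apply, Pi.single_eq_same] at h1
    have h4 : ∑ y, |(1 : Matrix V V ℝ) x y - π y| = 2 * (1 - π x) := by
      have h5 : π x ≤ 1 := by
        rw [← h.stationary.sum_eq_one]
        exact single_le_sum (fun y _ => h.stationary.nonneg y) (mem_univ x)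
      have h6 := h.stationary.sum_eq_one
      rw [← add_sum_erase _ _ (mem_univ x)] at h6 ⊢
      rw [Matrix.one_apply_eq, abs_of_nonneg (by linarith), sum_congr rfl (g := π)]
      · linarith
      · intro y hy
        rw [Matrix.one_apply_ne (ne_of_mem_erase hy).symm, zero_sub, abs_neg,
          abs_of_nonneg (h.stationary.nonneg y)]
    simp only [tvDist, pow_zero, h4]
    linarith
  set r := ⌈80 * T⌉₊ with hr
  have hr0 : 0 < r := Nat.ceil_pos.2 (by linarith)
  have hle : tLazy P π (1 / 4) ≤ 3 * r := Nat.sInf_le <| dLazy_le_iff.2 fun x =>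
    h.isPositiveChain_lazyMatrix.tvDist_pow_le (T := 2 * T)
      (fun x => by
        obtain ⟨G, hG, hGT⟩ := hG x
        refine ⟨_, hG.lazyMatrix, ?_⟩
        simp only [Pi.smul_apply, smul_eq_mul, ← mul_sum]
        linarith)
      hr0 ((by linarith : 40 * (2 * T) ≤ 80 * T).trans (Nat.le_ceil _)) x
  have h1 : (r : ℝ) < 80 * T + 1 := Nat.ceil_lt_add_one (by linarith)
  have h2 : (tLazy P π (1 / 4) : ℝ) ≤ 3 * r := by exact_mod_cast hle
  linarith

end Minorization

/-! ### Stopping times and their occupation vectors -/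

section StoppingTimes

open scoped Matrix
open Finset Filter Topology ProbabilityTheory

lemma measure_eq_sum_fiber {Ω V : Type*} [MeasurableSpace Ω] [Fintype V] (μ : Measure Ω)
    {X : Ω → V} (hX : ∀ y, MeasurableSet {ω | X ω = y}) (B : Set Ω) :
    μ B = ∑ y, μ {ω | ω ∈ B ∧ X ω = y} := by
  have h := sum_measure_preimage_singleton (μ := μ.restrict B) univ (f := X) fun y _ => hX y
  rw [coe_univ, Set.preimage_univ, Measure.restrict_apply_univ] at h
  rw [← h]
  refine sum_congr rfl fun y _ => ?_
  have hy : MeasurableSet (X ⁻¹' {y}) := hX y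
  rw [Measure.restrict_apply hy, Set.inter_comm]
  rfl

lemma ENat.toENNReal_eq_tsum (m : ℕ∞) :
    (m : ℝ≥0∞) = ∑' n : ℕ, if (n : ℕ∞) < m then 1 else 0 := by
  induction m using ENat.recTopCoe with
  | top => simp
  | coe k =>
    rw [tsum_eq_sum (s := range k) fun n hn => by simpa using hn, sum_congr rfl (g := fun _ => 1)]
    · simp
    · intro n hn
      simpa using hn

lemma lintegral_toENNReal_eq_tsum {Ω : Type*} [MeasurableSpace Ω] (μ : Measure Ω) {Λ : Ω → ℕ∞}
    (hΛ : ∀ n : ℕ, MeasurableSet {ω | (n : ℕ∞) < Λ ω}) :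
    ∫⁻ ω, (Λ ω : ℝ≥0∞) ∂μ = ∑' n : ℕ, μ {ω | (n : ℕ∞) < Λ ω} := by
  have h (ω : Ω) : (Λ ω : ℝ≥0∞) =
      ∑' n : ℕ, Set.indicator {ω | (n : ℕ∞) < Λ ω} (fun _ => 1) ω := by
    rw [ENat.toENNReal_eq_tsum]
    simp [Set.indicator_apply]
  simp only [h]
  rw [lintegral_tsum fun n => (measurable_const.indicator (hΛ n)).aemeasurable]
  simp [hΛ]

variable {V : Type*} [Fintype V] [DecidableEq V] {P : Matrix V V ℝ} {π : V → ℝ} {x : V}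

/-- The expected numbers of visits before a stationary stopping time of finite mean form an
occupation vector. -/
theorem exists_isOccupation_of_mem_stationaryStoppingMeans (hP : P ∈ Matrix.rowStochastic ℝ V)
    (hπ : ∀ y, 0 ≤ π y) {e : ℝ≥0∞} (he : e ∈ stationaryStoppingMeans P π x) (hetop : e ≠ ⊤) :
    ∃ G, IsOccupation P π x G ∧ ∑ y, G y = e.toReal := by
  obtain ⟨Ω, m, μ, ℱ, X, Λ, hμ, hX, hΛ, hlaw, rfl⟩ := he
  have hXm (n : ℕ) (y : V) : MeasurableSet {ω | X n ω = y} := ℱ.le n _ (hX.adapted n y)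
  have hΛl (n : ℕ) : MeasurableSet[ℱ n] {ω | (n : ℕ∞) < Λ ω} := by
    have := (hΛ n).compl
    convert this using 1
    ext ω
    exact (not_le (a := Λ ω)).symm
  have hΛm (n : ℕ) : MeasurableSet {ω | (n : ℕ∞) < Λ ω} := ℱ.le n _ (hΛl n)
  have hΛe (n : ℕ) : MeasurableSet {ω | Λ ω = n} := ℱ.le n _ (hΛ.measurableSet_eq n)
  set F : ℕ → V → ℝ≥0∞ := fun n y => μ {ω | ω ∈ {ω | (n : ℕ∞) < Λ ω} ∧ X n ω = y} with hF
  set S : ℕ → V → ℝ≥0∞ := fun n y => μ {ω | Λ ω = n ∧ X n ω = y} with hS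
  have hSm (n : ℕ) (y : V) : MeasurableSet {ω | Λ ω = n ∧ X n ω = y} := (hΛe n).inter (hXm n y)
  have hFS (n : ℕ) (y : V) : F n y + S n y = μ {ω | (n : ℕ∞) ≤ Λ ω ∧ X n ω = y} := by
    rw [← measure_union _ (hSm n y)]
    · congr 1
      ext ω
      simp only [Set.mem_union, Set.mem_ofPred_eq, le_iff_lt_or_eq, eq_comm (a := Λ ω)]
      tauto
    · refine Set.disjoint_left.2 fun ω h1 h2 => ?_
      exact h1.1.ne' h2.1
  have hFS0 (y : V) : F 0 y + S 0 y = ENNReal.ofReal ((Pi.single x 1 : V → ℝ) y) := by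
    rw [hFS]
    by_cases hy : y = x
    · subst hy
      rw [Pi.single_eq_same, ENNReal.ofReal_one, ← measure_univ (μ := μ)]
      refine measure_congr (eventuallyEq_set.2 ?_)
      filter_upwards [hX.start] with ω hω
      simp [hω]
    · rw [Pi.single_eq_of_ne hy, ENNReal.ofReal_zero, measure_eq_zero_iff_ae_notMem]
      filter_upwards [hX.start] with ω hω h
      exact hy (h.2.symm.trans hω)
  -- Not having stopped by time `n` is an event of `ℱ n`, so the Markov property applies to it.
  have hFS1 (n : ℕ) (z : V) : F (n + 1) z + S (n + 1) z = ∑ y, F n y * ENNReal.ofReal (P y z) := by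
    rw [hFS, measure_eq_sum_fiber μ (hXm n)]
    refine sum_congr rfl fun y _ => ?_
    rw [hF, ← hX.markov n _ (hΛl n)]
    congr 1
    ext ω
    have : ((n + 1 : ℕ) : ℕ∞) ≤ Λ ω ↔ (n : ℕ∞) < Λ ω := by
      rw [Nat.cast_add, Nat.cast_one, ENat.add_one_le_iff (ENat.natCast_ne_top n)]
    simp only [Set.mem_ofPred_eq, this]
    tauto
  have hSsum (y : V) : ∑' n, S n y = ENNReal.ofReal (π y) := by
    rw [← hlaw, ← measure_iUnion _ fun n => hSm n y]
    · congr 1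
      ext ω
      simp
    · refine fun i j hij => Set.disjoint_left.2 fun ω h1 h2 => hij ?_
      exact_mod_cast h1.1.symm.trans h2.1
  have hmean : ∑ y, ∑' n, F n y = ∫⁻ ω, (Λ ω : ℝ≥0∞) ∂μ := by
    rw [lintegral_toENNReal_eq_tsum μ hΛm, ← Summable.tsum_finsetSum fun _ _ => ENNReal.summable]
    refine tsum_congr fun n => ?_
    rw [measure_eq_sum_fiber μ (hXm n)]
  have hfin (y : V) : ∑' n, F n y ≠ ⊤ := by
    refine ne_top_of_le_ne_top hetop ?_
    rw [← hmean]
    exact single_le_sum (f := fun y => ∑' n, F n y) (fun _ _ => zero_le) (mem_univ y)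
  -- Visits at all times, split once into moving or stopping and once into the start and arrivals
  -- from the previous site.
  have hbal (z : V) : ∑' n, F n z + ENNReal.ofReal (π z) =
      ENNReal.ofReal ((Pi.single x 1 : V → ℝ) z) + ∑ y, (∑' n, F n y) * ENNReal.ofReal (P y z) := by
    rw [← hSsum, ← ENNReal.tsum_add, tsum_eq_zero_add' ENNReal.summable, hFS0]
    simp only [hFS1]
    rw [Summable.tsum_finsetSum fun _ _ => ENNReal.summable]
    simp only [ENNReal.tsum_mul_right]
  refine ⟨fun y => (∑' n, F n y).toReal, ⟨fun y => ENNReal.toReal_nonneg, ?_⟩, ?_⟩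
  · ext z
    have h := congrArg ENNReal.toReal (hbal z)
    rw [ENNReal.toReal_add (hfin z) ENNReal.ofReal_ne_top, ENNReal.toReal_add ENNReal.ofReal_ne_top
      (ENNReal.sum_ne_top.2 fun y _ => ENNReal.mul_ne_top (hfin y) ENNReal.ofReal_ne_top),
      ENNReal.toReal_sum fun y _ => ENNReal.mul_ne_top (hfin y) ENNReal.ofReal_ne_top,
      ENNReal.toReal_ofReal (hπ z), ENNReal.toReal_ofReal (single_one_nonneg x z)] at h
    simp only [ENNReal.toReal_mul, ENNReal.toReal_ofReal (hP.1 _ _)] at h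
    exact h
  · rw [← hmean, ENNReal.toReal_sum fun y _ => hfin y]

/-! ### Realizing a stopping flow by a randomized stopping time -/

/-- Existence of a time-inhomogeneous Markov chain on a finite state space. -/
theorem exists_markovChain {W : Type*} [Fintype W] [MeasurableSpace W] [MeasurableSingletonClass W]
    (p₀ : PMF W) (p : ℕ → W → PMF W) :
    ∃ μ : Measure (ℕ → W), IsProbabilityMeasure μ ∧ (∀ w, μ {ω | ω 0 = w} = p₀ w) ∧
      ∀ n (A : Set (ℕ → W)), MeasurableSet[Filtration.piLE n] A → ∀ w w',
        μ {ω | ω ∈ A ∧ ω n = w ∧ ω (n + 1) = w'} = μ {ω | ω ∈ A ∧ ω n = w} * p n w w' := by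
  let κ₀ (n : ℕ) : Kernel W W := Kernel.ofFunOfCountable fun w => (p n w).toMeasure
  have hκ₀ (n : ℕ) : IsMarkovKernel (κ₀ n) := ⟨fun w => by
    change IsProbabilityMeasure (p n w).toMeasure
    infer_instance⟩
  -- Ionescu-Tulcea kernels on histories that read only the last coordinate.
  let κ (n : ℕ) : Kernel (Π _ : Iic n, W) W :=
    (κ₀ n).comap (fun u => u ⟨n, mem_Iic.2 le_rfl⟩) (measurable_pi_apply _)
  have hκ (n : ℕ) : IsMarkovKernel (κ n) := inferInstance
  refine ⟨Kernel.trajMeasure (X := fun _ => W) p₀.toMeasure κ, inferInstance, fun w => ?_,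
    fun n A hA w w' => ?_⟩
  · have h : (Kernel.trajMeasure (X := fun _ => W) p₀.toMeasure κ).map
        (Preorder.frestrictLe 0) =
        p₀.toMeasure.map (MeasurableEquiv.piUnique (fun _ : Iic 0 => W)).symm := by
      rw [Kernel.trajMeasure, Measure.map_comp _ _ (by fun_prop), Kernel.traj_map_frestrictLe,
        Kernel.partialTraj_self, Measure.id_comp]
    have h1 : MeasurableSet {u : Π _ : Iic 0, W | u ⟨0, mem_Iic.2 le_rfl⟩ = w} :=
      (measurable_pi_apply (X := fun _ => W) (⟨0, mem_Iic.2 le_rfl⟩ : Iic 0))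
        (measurableSet_singleton w)
    have h2 := congrArg (fun ν => ν {u | u ⟨0, mem_Iic.2 le_rfl⟩ = w}) h
    rw [Measure.map_apply (by fun_prop) h1, Measure.map_apply (MeasurableEquiv.measurable _) h1]
      at h2
    rw [← PMF.toMeasure_apply_singleton p₀ w (measurableSet_singleton w)]
    exact h2
  · rw [Filtration.piLE_eq_comap_frestrictLe] at hA
    obtain ⟨A', hA', rfl⟩ := hA
    have hw : MeasurableSet {u : Π _ : Iic n, W | u ⟨n, mem_Iic.2 le_rfl⟩ = w} :=
      (measurable_pi_apply (X := fun _ => W) (⟨n, mem_Iic.2 le_rfl⟩ : Iic n))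
        (measurableSet_singleton w)
    have h := congrArg (fun ν => ν ((A' ∩ {u | u ⟨n, mem_Iic.2 le_rfl⟩ = w}) ×ˢ {w'}))
      (Kernel.map_frestrictLe_trajMeasure_compProd_eq_map_trajMeasure (X := fun _ => W)
        (μ₀ := p₀.toMeasure) (κ := κ) (a := n))
    rw [Measure.compProd_apply_prod (hA'.inter hw) (measurableSet_singleton w'),
      Measure.map_apply (by fun_prop) ((hA'.inter hw).prod (measurableSet_singleton w')),
      setLIntegral_congr_fun (g := fun _ => p n w w') (hA'.inter hw), setLIntegral_const,
      Measure.map_apply (by fun_prop) (hA'.inter hw), mul_comm] at h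
    · refine Eq.trans ?_ h.symm
      congr 1
      ext ω
      simp only [Set.mem_ofPred_eq, Set.mem_preimage, Set.mem_prod, Set.mem_inter_iff,
        Set.mem_singleton_iff, ← and_assoc]
      rfl
    · intro u hu
      change (p n (u ⟨n, mem_Iic.2 le_rfl⟩)).toMeasure {w'} = _
      rw [hu.2, PMF.toMeasure_apply_singleton _ _ (measurableSet_singleton w')]

/-- The conditional probability of stopping (`true`) or moving on (`false`) at time `n` in `y`. -/
noncomputable def stopProb (s g : ℕ → V → ℝ) (n : ℕ) (y : V) (b : Bool) : ℝ :=
  if b then s n y / (s n y + g n y) else 1 - s n y / (s n y + g n y)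

namespace IsStoppingFlow

variable {s g : ℕ → V → ℝ}

lemma stopProb_nonneg (h : IsStoppingFlow P π x s g) (n : ℕ) (y : V) (b : Bool) :
    0 ≤ stopProb s g n y b := by
  have h1 := h.stop_nonneg n y
  have h2 := h.go_nonneg n y
  have h3 : s n y / (s n y + g n y) ≤ 1 := div_le_one_of_le₀ (by linarith) (by linarith)
  cases b
  · simpa [stopProb] using h3
  · simpa [stopProb] using div_nonneg h1 (by linarith)

/-- At a site without mass the quotient is `0 / 0 = 0`, which is harmless since both parts vanish
there. -/
lemma add_mul_stopProb (h : IsStoppingFlow P π x s g) (n : ℕ) (y : V) (b : Bool) :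
    (s n y + g n y) * stopProb s g n y b = if b then s n y else g n y := by
  have h1 := h.stop_nonneg n y
  have h2 := h.go_nonneg n y
  rcases eq_or_ne (s n y + g n y) 0 with h0 | h0
  · cases b <;> simp [h0] <;> linarith
  · cases b <;> simp [stopProb] <;> field_simp
    ring

/-- One step of the chain with stopping flags, from the row `r`. -/
noncomputable def flagged (h : IsStoppingFlow P π x s g) (n : ℕ) (r : V → ℝ) (hr : ∀ y, 0 ≤ r y)
    (hr1 : ∑ y, r y = 1) : PMF (V × Bool) :=
  PMF.ofFintype (fun w => ENNReal.ofReal (r w.1 * stopProb s g n w.1 w.2)) (by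
    rw [← ENNReal.ofReal_sum_of_nonneg fun w _ => mul_nonneg (hr _) (h.stopProb_nonneg _ _ _),
      Fintype.sum_prod_type]
    simp [stopProb, ← mul_add, hr1])

end IsStoppingFlow

/-- The first time at which the flag is raised. -/
noncomputable def firstFlag {Ω : Type*} (b : ℕ → Ω → Bool) (ω : Ω) : ℕ∞ :=
  ⨅ n : {n // b n ω = true}, (n : ℕ∞)

lemma firstFlag_le_iff {Ω : Type*} {b : ℕ → Ω → Bool} {ω : Ω} {n : ℕ} :
    firstFlag b ω ≤ n ↔ ∃ k ≤ n, b k ω = true := by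
  constructor
  · intro h
    by_contra! hk
    have : ((n + 1 : ℕ) : ℕ∞) ≤ firstFlag b ω := by
      refine le_iInf fun k => ?_
      by_contra! hlt
      exact hk k (by exact_mod_cast Nat.lt_succ_iff.1 (by exact_mod_cast hlt)) k.2
    have := this.trans h
    norm_cast at this
    lia
  · rintro ⟨k, hk, hb⟩
    exact (iInf_le (fun n : {n // b n ω = true} => (n : ℕ∞)) ⟨k, hb⟩).trans (by exact_mod_cast hk)

lemma lt_firstFlag_iff {Ω : Type*} {b : ℕ → Ω → Bool} {ω : Ω} {n : ℕ} :
    (n : ℕ∞) < firstFlag b ω ↔ ∀ k < n + 1, b k ω = false := by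
  rw [← not_le, firstFlag_le_iff]
  simp

lemma firstFlag_eq_iff {Ω : Type*} {b : ℕ → Ω → Bool} {ω : Ω} {n : ℕ} :
    firstFlag b ω = n ↔ (∀ k < n, b k ω = false) ∧ b n ω = true := by
  constructor
  · intro h
    have h1 (k : ℕ) (hk : k < n) : b k ω = false := by
      by_contra hb
      have := firstFlag_le_iff.2 ⟨k, le_rfl, by simpa using hb⟩
      rw [h] at this
      norm_cast at this
      lia
    refine ⟨h1, ?_⟩
    obtain ⟨k, hk, hb⟩ := firstFlag_le_iff.1 h.le
    rcases hk.lt_or_eq with hlt | rfl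
    · simp [h1 k hlt] at hb
    · exact hb
  · rintro ⟨h1, h2⟩
    refine le_antisymm (firstFlag_le_iff.2 ⟨n, le_rfl, h2⟩) ?_
    cases n with
    | zero => simp
    | succ n =>
      rw [Nat.cast_add, Nat.cast_one, ENat.add_one_le_iff (ENat.natCast_ne_top n)]
      exact lt_firstFlag_iff.2 h1

namespace IsStoppingFlow

variable {s g : ℕ → V → ℝ}

lemma sum_go_eq_tsum_bound (h : IsStoppingFlow P π x s g) {C : ℝ}
    (hC : ∀ n, ∑ k ∈ range n, ∑ y, g k y ≤ C) :
    ∑' n, ENNReal.ofReal (∑ y, g n y) ≤ ENNReal.ofReal C := by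
  refine ENNReal.tsum_le_of_sum_range_le fun n => ?_
  rw [← ENNReal.ofReal_sum_of_nonneg fun k _ => sum_nonneg fun y _ => h.go_nonneg k y]
  exact ENNReal.ofReal_le_ofReal (hC n)

/-- A stopping flow is realized by a randomized stopping time of the chain. -/
theorem exists_mem_stationaryStoppingMeans (h : IsStoppingFlow P π x s g)
    (hP : P ∈ Matrix.rowStochastic ℝ V) :
    ∑' n, ENNReal.ofReal (∑ y, g n y) ∈ stationaryStoppingMeans P π x := by
  let _ : MeasurableSpace V := ⊤
  have : MeasurableSingletonClass V := ⟨fun _ => trivial⟩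
  -- The transition ignores the old flag and draws a new one, so the first coordinate remains a
  -- `P`-chain in the larger filtration, also after a flag is raised.
  obtain ⟨μ, hμ, hμ0, hμ1⟩ := exists_markovChain
    (h.flagged 0 (Pi.single x 1) (single_one_nonneg x) (sum_single_one x))
    fun n w => h.flagged (n + 1) (P w.1) (hP.1 w.1) (Matrix.sum_row_of_mem_rowStochastic hP w.1)
  have hcoord (n : ℕ) (w : V × Bool) : MeasurableSet[Filtration.piLE n]
      {ω : ℕ → V × Bool | ω n = w} := by
    rw [Filtration.piLE_eq_comap_frestrictLe]
    exact ⟨{u | u ⟨n, mem_Iic.2 le_rfl⟩ = w},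
      (measurable_pi_apply (X := fun _ => V × Bool) (⟨n, mem_Iic.2 le_rfl⟩ : Iic n))
        (measurableSet_singleton w), rfl⟩
  have hcoord' (n : ℕ) (S : Set (V × Bool)) : MeasurableSet[Filtration.piLE n]
      {ω : ℕ → V × Bool | ω n ∈ S} := by
    have : {ω : ℕ → V × Bool | ω n ∈ S} = ⋃ w ∈ S, {ω | ω n = w} := by
      ext ω
      simp
    rw [this]
    exact MeasurableSet.biUnion S.to_countable fun w _ => hcoord n w
  have hflag (n m : ℕ) (hnm : n ≤ m + 1) : MeasurableSet[Filtration.piLE m]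
      {ω : ℕ → V × Bool | ∀ k < n, (ω k).2 = false} := by
    have : {ω : ℕ → V × Bool | ∀ k < n, (ω k).2 = false} =
        ⋂ k ∈ range n, {ω | ω k ∈ {w : V × Bool | w.2 = false}} := by
      ext ω
      simp
    rw [this]
    refine (range n).measurableSet_biInter fun k hk => ?_
    exact Filtration.piLE.mono (by have := mem_range.1 hk; lia) _ (hcoord' k _)
  have hX (n : ℕ) (y : V) : MeasurableSet {ω : ℕ → V × Bool | (ω n).1 = y} :=
    Filtration.piLE.le n _ (hcoord' n {w | w.1 = y})
  have hflow (n : ℕ) (y : V) (b : Bool) :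
      μ {ω | ω ∈ {ω | ∀ k < n, (ω k).2 = false} ∧ ω n = (y, b)} =
        ENNReal.ofReal (if b then s n y else g n y) := by
    induction n generalizing y b with
    | zero =>
      have hi := congrFun h.init y
      rw [Pi.add_apply] at hi
      have : {ω : ℕ → V × Bool | ω ∈ {ω | ∀ k < 0, (ω k).2 = false} ∧ ω 0 = (y, b)} =
          {ω | ω 0 = (y, b)} := by
        ext ω
        simp
      rw [this, hμ0, ← h.add_mul_stopProb, hi]
      rfl
    | succ n ih =>
      have hi := congrFun (h.step n) y
      rw [Pi.add_apply] at hi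
      rw [measure_eq_sum_fiber μ (hX n), ← h.add_mul_stopProb, hi]
      simp only [Matrix.vecMul, dotProduct]
      rw [sum_mul, ENNReal.ofReal_sum_of_nonneg fun z _ => mul_nonneg
        (mul_nonneg (h.go_nonneg n z) (hP.1 z y)) (h.stopProb_nonneg _ _ _)]
      refine sum_congr rfl fun z _ => ?_
      have h1 := hμ1 n _ (hflag n n (by lia)) (z, false) (y, b)
      rw [ih] at h1
      simp only [Bool.false_eq_true, if_false] at h1
      rw [mul_assoc, ENNReal.ofReal_mul (h.go_nonneg n z)]
      refine Eq.trans ?_ h1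
      congr 1
      ext ω
      simp only [Set.mem_ofPred_eq, Nat.forall_lt_succ_right, Prod.ext_iff]
      tauto
  have hstopped (n : ℕ) (y : V) :
      μ {ω | firstFlag (fun n ω => (ω n).2) ω = n ∧ (ω n).1 = y} = ENNReal.ofReal (s n y) := by
    have := hflow n y true
    rw [if_pos rfl] at this
    rw [← this]
    congr 1
    ext ω
    simp only [Set.mem_ofPred_eq, firstFlag_eq_iff, Prod.ext_iff]
    tauto
  have hgo (n : ℕ) :
      μ {ω | (n : ℕ∞) < firstFlag (fun n ω => (ω n).2) ω} = ENNReal.ofReal (∑ y, g n y) := by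
    rw [measure_eq_sum_fiber μ (hX n), ENNReal.ofReal_sum_of_nonneg fun y _ => h.go_nonneg n y]
    refine sum_congr rfl fun y _ => ?_
    have := hflow n y false
    simp only [Bool.false_eq_true, if_false] at this
    rw [← this]
    congr 1
    ext ω
    simp only [Set.mem_ofPred_eq, lt_firstFlag_iff, Prod.ext_iff, Nat.forall_lt_succ_right]
    tauto
  have hlt (n : ℕ) : MeasurableSet[Filtration.piLE n]
      {ω : ℕ → V × Bool | (n : ℕ∞) < firstFlag (fun n ω => (ω n).2) ω} := by
    simp only [lt_firstFlag_iff]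
    exact hflag (n + 1) n le_rfl
  -- This path space lives in the universe of `V`, as the set of means demands.
  refine ⟨ℕ → V × Bool, inferInstance, μ, Filtration.piLE, fun n ω => (ω n).1,
    firstFlag fun n ω => (ω n).2, hμ, ⟨fun n y => hcoord' n {w | w.1 = y}, ?_, ?_⟩, fun n => ?_,
    fun y => ?_, ?_⟩
  · have h1 (y : V) (hy : y ≠ x) : μ {ω | (ω 0).1 = y} = 0 := by
      have hb (b : Bool) : μ {ω | ω 0 = (y, b)} = 0 := by
        rw [hμ0]
        simp [flagged, hy]
      refine measure_mono_null (t := ⋃ b : Bool, {ω | ω 0 = (y, b)}) (fun ω hω => ?_)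
        (measure_iUnion_null hb)
      exact Set.mem_iUnion.2 ⟨(ω 0).2, Prod.ext hω rfl⟩
    rw [ae_iff]
    refine measure_mono_null (t := ⋃ y : {y // y ≠ x}, {ω | (ω 0).1 = y}) (fun ω hω => ?_)
      (measure_iUnion_null fun y => h1 y y.2)
    exact Set.mem_iUnion.2 ⟨⟨_, hω⟩, rfl⟩
  · intro n A hA y z
    have hb (i : ℕ) (b : Bool) : MeasurableSet {ω : ℕ → V × Bool | (ω i).2 = b} :=
      Filtration.piLE.le i _ (hcoord' i {w | w.2 = b})
    rw [measure_eq_sum_fiber μ (hb n), measure_eq_sum_fiber μ (hb n) {ω | ω ∈ A ∧ (ω n).1 = y},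
      sum_mul]
    refine sum_congr rfl fun b _ => ?_
    rw [measure_eq_sum_fiber μ (hb (n + 1))]
    have h1 (b' : Bool) : μ {ω | ω ∈ {ω | ω ∈ {ω | ω ∈ A ∧ (ω n).1 = y ∧ (ω (n + 1)).1 = z} ∧
        (ω n).2 = b} ∧ (ω (n + 1)).2 = b'} =
        μ {ω | ω ∈ {ω | ω ∈ A ∧ (ω n).1 = y} ∧ (ω n).2 = b} *
          ENNReal.ofReal (P y z * stopProb s g (n + 1) z b') := by
      have h2 := hμ1 n A hA (y, b) (z, b')
      convert h2 using 2
      · ext ω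
        simp only [Set.mem_ofPred_eq, Prod.ext_iff]
        tauto
      · congr 1
        ext ω
        simp only [Set.mem_ofPred_eq, Prod.ext_iff]
        tauto
      · rfl
    simp only [h1]
    rw [← mul_sum, ← ENNReal.ofReal_sum_of_nonneg fun b' _ => mul_nonneg (hP.1 y z)
      (h.stopProb_nonneg _ _ _)]
    simp [stopProb, ← mul_add]
  · convert (hlt n).compl using 1
    ext ω
    exact (not_lt (b := firstFlag (fun n ω => (ω n).2) ω)).symm
  · have h1 := (ENNReal.ofReal_tsum_of_nonneg (fun n => h.stop_nonneg n y)
      (h.hasSum y).summable).symm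
    rw [(h.hasSum y).tsum_eq] at h1
    rw [← h1]
    simp only [← hstopped]
    rw [← measure_iUnion]
    · congr 1
      ext ω
      simp
    · refine fun i j hij => Set.disjoint_left.2 fun ω hi hj => hij ?_
      exact_mod_cast hi.1.symm.trans hj.1
    · intro n
      simp only [firstFlag_eq_iff]
      exact ((Filtration.piLE.le n _ (hflag n n (by lia))).inter
        (Filtration.piLE.le n _ (hcoord' n {w | w.2 = true}))).inter (hX n y)
  · rw [lintegral_toENNReal_eq_tsum μ fun n => Filtration.piLE.le n _ (hlt n)]
    exact tsum_congr fun n => (hgo n).symm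

end IsStoppingFlow

lemma IsOccupation.sInf_stationaryStoppingMeans_le {G : V → ℝ} (hG : IsOccupation P π x G)
    (hP : P ∈ Matrix.rowStochastic ℝ V) (hπ : ∀ y, 0 ≤ π y) (hπ1 : ∑ y, π y = 1) :
    sInf (stationaryStoppingMeans P π x) ≤ ENNReal.ofReal (∑ y, G y) := by
  obtain ⟨s, g, hsg, hg⟩ := exists_isStoppingFlow hP hπ hπ1 hG
  exact (sInf_le (hsg.exists_mem_stationaryStoppingMeans hP)).trans (hsg.sum_go_eq_tsum_bound hg)

/-- Up to a universal constant, `tStop` is at most the mixing time of the lazy chain. -/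
theorem IsReversibleChain.tStop_le (h : IsReversibleChain P π) :
    tStop P π ≤ 4 * (tLazy P π (1 / 4) : ℝ≥0∞) := by
  refine iSup_le fun x => ?_
  obtain ⟨G, hG, hGs⟩ := h.exists_isOccupation x
  refine (hG.sInf_stationaryStoppingMeans_le h.stochastic h.stationary.nonneg
    h.stationary.sum_eq_one).trans ?_
  rw [hGs, ENNReal.ofReal_mul (by norm_num), ENNReal.ofReal_natCast]
  norm_num

/-- Up to a universal constant, the mixing time of the lazy chain is at most `tStop`. -/
theorem IsReversibleChain.tLazy_le_tStop (h : IsReversibleChain P π) :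
    (tLazy P π (1 / 4) : ℝ≥0∞) ≤ 264 * tStop P π := by
  -- Strict inequality lets each state choose an actual stopping time of mean below `T`, without the
  -- infimum being attained.
  have key (T : ℝ≥0∞) (hT : tStop P π < T) : (tLazy P π (1 / 4) : ℝ≥0∞) / 264 ≤ T := by
    rcases eq_or_ne T ⊤ with rfl | hTtop
    · exact le_top
    have h1 : (tLazy P π (1 / 4) : ℝ) ≤ 264 * T.toReal := h.tLazy_le fun x => by
      obtain ⟨e, he, heT⟩ := sInf_lt_iff.1 ((le_iSup (fun x =>
        sInf (stationaryStoppingMeans P π x)) x).trans_lt hT)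
      obtain ⟨G, hG, hGe⟩ := exists_isOccupation_of_mem_stationaryStoppingMeans h.stochastic
        h.stationary.nonneg he heT.ne_top
      exact ⟨G, hG, hGe.trans_le (ENNReal.toReal_mono hTtop heT.le)⟩
    refine ENNReal.div_le_of_le_mul' ?_
    rw [← ENNReal.ofReal_toReal hTtop, ← ENNReal.ofReal_natCast,
      show (264 : ℝ≥0∞) = ENNReal.ofReal 264 by norm_num, ← ENNReal.ofReal_mul (by norm_num)]
    exact ENNReal.ofReal_le_ofReal h1
  have := le_of_forall_gt_imp_ge_of_dense key
  rwa [ENNReal.div_le_iff (by norm_num) (by norm_num), mul_comm] at this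

end StoppingTimes

theorem mainTheorem5 :
    ∃ c c' : ℝ≥0, 0 < c ∧ 0 < c' ∧
      ∀ (V : Type*) [Fintype V] [DecidableEq V] (P : Matrix V V ℝ) (π : V → ℝ),
        IsReversibleChain P π →
          (∃ t : ℕ, dLazy P π t ≤ 1 / 4) ∧
          (c : ℝ≥0∞) * (tLazy P π (1 / 4) : ℝ≥0∞) ≤ tStop P π ∧
          tStop P π ≤ (c' : ℝ≥0∞) * (tLazy P π (1 / 4) : ℝ≥0∞) := by
  refine ⟨264⁻¹, 4, by norm_num, by norm_num, fun V _ _ P π h => ⟨h.exists_dLazy_le, ?_, ?_⟩⟩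
  · rw [ENNReal.coe_inv (by norm_num)]
    exact ENNReal.inv_mul_le_iff (by norm_num) (by norm_num) |>.2 h.tLazy_le_tStop
  · exact h.tStop_le
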